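/- For $\lambda\in\mathbb{R}$ and $0<\alpha\le 1$ let $L(\lambda,\alpha,s)$ denote the Lerch zeta-function: if $\lambda\notin\mathbb{Z}$, it is the sum of the convergent series $\sum_{n=0}^{\infty}e^{2\pi i\lambda n}(n+\alpha)^{-s}$ for $\operatorname{Re}s>0$; if $\lambda\in\mathbb{Z}$, it is the Hurwitz zeta-function $\zeta(s,\alpha)$, that is, the meromorphic continuation of $\sum_{n=0}^{\infty}(n+\alpha)^{-s}$ ($\operatorname{Re}s>1$), whose only singularity is a simple pole at $s=1$. Let $\lambda\in\mathbb{R}$, $0<\alpha\le1$, $\sigma_1>0$ and $\varepsilon_1>0$. Then there exist $T_0>0$ and $C>0$, depending only on $\lambda,\alpha,\sigma_1,\varepsilon_1$, such that for all $T\ge T_0$ and all real $\sigma$ with $\tfrac12+\varepsilon_1\le\sigma\le\sigma_1$ the function $t\mapsto\log^2|L(\lambda,\alpha,\sigma+it)|$ is integrable on $[0,T]$ and \[\int_0^T\log^2|L(\lambda,\alpha,\sigma+it)|\,dt\le C\,T .\] -/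

import Mathlib

open Filter Topology

/-- The partial sum `∑_{0 ≤ n < N} e^{2πiλn} / (n + α)^s` of the Lerch series. -/
noncomputable def lerchPartialSum (lam α : ℝ) (s : ℂ) (N : ℕ) : ℂ :=
  ∑ n ∈ Finset.range N,
    Complex.exp (2 * Real.pi * Complex.I * lam * n) / ((n : ℂ) + (α : ℂ)) ^ s

theorem lerch_exp_sum_bounded (lam : ℝ) (h : ¬ ∃ k : ℤ, (k : ℝ) = lam) : ∃ B, ∀ N : ℕ,
    ‖∑ n ∈ Finset.range N, Complex.exp (2 * Real.pi * Complex.I * lam * n)‖ ≤ B := by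
  set q := Complex.exp (2 * Real.pi * Complex.I * lam) with hq
  have h1 : q ≠ 1 := by
    intro h1
    rw [Complex.exp_eq_one_iff] at h1
    obtain ⟨k, hk⟩ := h1
    refine h ⟨k, ?_⟩
    have : (2 * Real.pi * Complex.I) * ((k : ℂ) - lam) = 0 := by linear_combination -hk
    rcases mul_eq_zero.1 this with h2 | h2
    · exact absurd h2 Complex.two_pi_I_ne_zero
    · exact_mod_cast sub_eq_zero.1 h2
  have hn : ‖q‖ = 1 := by
    rw [hq, Complex.norm_exp]; simp
  refine ⟨2 / ‖q - 1‖, fun N => ?_⟩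
  have : ∀ n : ℕ, Complex.exp (2 * Real.pi * Complex.I * lam * n) = q ^ n := by
    intro n; rw [hq, ← Complex.exp_nat_mul]; ring_nf
  simp only [this]
  rw [geom_sum_eq h1, norm_div]
  gcongr
  calc ‖q ^ N - 1‖ ≤ ‖q ^ N‖ + ‖(1 : ℂ)‖ := norm_sub_le _ _
    _ = 2 := by rw [norm_pow, hn]; norm_num

theorem lerch_cpow_sub_bound (α : ℝ) (hα : 0 < α) (s : ℂ) (hs : 0 < s.re) (n : ℕ) :
    ‖(((n + 1 : ℕ) : ℂ) + α) ^ (-s) - ((n : ℂ) + α) ^ (-s)‖ ≤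
      ‖s‖ * (n + α) ^ (-s.re - 1) := by
  have hpos : (0 : ℝ) < n + α := by positivity
  have := (convex_Icc ((n : ℝ) + α) (n + 1 + α)).norm_image_sub_le_of_norm_hasDerivWithin_le
    (f := fun x : ℝ => (x : ℂ) ^ (-s)) (f' := fun x : ℝ => (-s) * (x : ℂ) ^ (-s - 1))
    (C := ‖s‖ * (n + α) ^ (-s.re - 1)) (x := n + α) (y := n + 1 + α) ?_ ?_ ?_ ?_
  · push_cast at this ⊢
    refine this.trans (le_of_eq ?_)
    rw [show ((n : ℝ) + 1 + α - (n + α)) = 1 by ring]; simp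
  · intro x hx
    have hx0 : 0 < x := hpos.trans_le hx.1
    have h0 : -s ≠ 0 := by intro h; rw [neg_eq_zero] at h; simp [h] at hs
    exact (hasDerivAt_ofReal_cpow_const (x := x) hx0.ne' h0).hasDerivWithinAt
  · intro x hx
    have hx0 : 0 < x := hpos.trans_le hx.1
    rw [norm_mul, norm_neg, Complex.norm_cpow_eq_rpow_re_of_pos hx0]
    gcongr
    simp only [Complex.sub_re, Complex.neg_re, Complex.one_re]
    exact Real.rpow_le_rpow_of_nonpos hpos hx.1 (by linarith)
  · constructor <;> linarith
  · constructor <;> linarith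

/-- For `λ` not an integer the Lerch series converges in `Re s > 0`. -/
theorem exists_tendsto_lerchPartialSum (lam α : ℝ) (h : ¬ ∃ k : ℤ, (k : ℝ) = lam) (hα : 0 < α) (s : ℂ)
    (hs : 0 < s.re) : ∃ z, Tendsto (lerchPartialSum lam α s) atTop (𝓝 z) := by
  obtain ⟨B, hB⟩ := lerch_exp_sum_bounded lam h
  set G := fun N => ∑ n ∈ Finset.range N, Complex.exp (2 * Real.pi * Complex.I * lam * n) with hG
  set f := fun n : ℕ => ((n : ℂ) + α) ^ (-s) with hf
  have hsum : Summable fun n : ℕ => (f (n + 1) - f n) * G (n + 1) := by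
    have h1 : Summable fun n : ℕ => (((n : ℝ) + α) ^ (-s.re - 1)) := by
      have := (Real.summable_one_div_nat_add_rpow α (s.re + 1)).2 (by linarith)
      refine this.congr fun n => ?_
      have : (0 : ℝ) < n + α := by positivity
      rw [abs_of_pos this, one_div, ← Real.rpow_neg this.le]; ring_nf
    refine Summable.of_norm_bounded ((h1.mul_left ‖s‖).mul_right B) fun n => ?_
    rw [norm_mul]
    gcongr
    · have := lerch_cpow_sub_bound α hα s hs n
      simpa [hf] using this
    · exact hB _
  have hf0 : Tendsto f atTop (𝓝 0) := by
    rw [tendsto_zero_iff_norm_tendsto_zero]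
    have h2 : Tendsto (fun n : ℕ => ((n : ℝ) + α) ^ (-s.re)) atTop (𝓝 0) :=
      (tendsto_rpow_neg_atTop hs).comp
        (tendsto_atTop_add_const_right _ _ tendsto_natCast_atTop_atTop)
    refine h2.congr fun n => ?_
    have : (0 : ℝ) < n + α := by positivity
    have e : f n = (((n : ℝ) + α : ℝ) : ℂ) ^ (-s) := by simp [hf]
    rw [e, Complex.norm_cpow_eq_rpow_re_of_pos this]; simp
  have key : ∀ N, lerchPartialSum lam α s (N + 1) =
      f N * G (N + 1) - ∑ n ∈ Finset.range N, (f (n + 1) - f n) * G (n + 1) := by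
    intro N
    have := Finset.sum_range_by_parts f
      (fun n : ℕ => Complex.exp (2 * Real.pi * Complex.I * lam * n)) (N + 1)
    simp only [smul_eq_mul, Nat.add_sub_cancel] at this
    rw [← this]
    refine Finset.sum_congr rfl fun n _ => ?_
    simp only [hf]
    rw [Complex.cpow_neg, div_eq_mul_inv, mul_comm]
  have h3 : Tendsto (fun N => f N * G (N + 1)) atTop (𝓝 0) := by
    refine squeeze_zero_norm (a := fun N => ‖f N‖ * B) (fun N => ?_) ?_
    · rw [norm_mul]; gcongr; exact hB _
    · simpa using hf0.norm.mul_const B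
  exact ⟨_, (tendsto_add_atTop_iff_nat 1).1
    ((h3.sub hsum.hasSum.tendsto_sum_nat).congr fun N => (key N).symm)⟩

open Classical in
/-- The Lerch zeta-function `L(λ, α, s)` for real `λ` and `0 < α ≤ 1`.
If `λ` is not an integer it is the sum of the (in general only conditionally convergent)
series `∑_{n ≥ 0} e^{2πiλn} / (n + α)^s` in the half-plane `Re s > 0`.
If `λ` is an integer it is the Hurwitz zeta-function `ζ(s, α)`, the meromorphic continuation
of `∑_{n ≥ 0} 1 / (n + α)^s`, holomorphic except for a simple pole at `s = 1`. -/
noncomputable def lerchZeta (lam α : ℝ) (s : ℂ) : ℂ :=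
  if ∃ k : ℤ, (k : ℝ) = lam then HurwitzZeta.hurwitzZeta (α : UnitAddCircle) s
  else limUnder atTop (lerchPartialSum lam α s)

theorem tendsto_lerchPartialSum (lam α : ℝ) (h : ¬ ∃ k : ℤ, (k : ℝ) = lam) (hα : 0 < α)
    (s : ℂ) (hs : 0 < s.re) :
    Tendsto (lerchPartialSum lam α s) atTop (𝓝 (lerchZeta lam α s)) := by
  rw [lerchZeta, if_neg h]
  exact tendsto_nhds_limUnder (exists_tendsto_lerchPartialSum lam α h hα s hs)

theorem hasSum_lerchZeta_of_int (k : ℤ) (α : ℝ) (hα : 0 < α) (hα' : α ≤ 1) (s : ℂ)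
    (hs : 1 < s.re) :
    HasSum (fun n : ℕ => 1 / ((n : ℂ) + (α : ℂ)) ^ s) (lerchZeta k α s) := by
  rw [lerchZeta, if_pos ⟨k, rfl⟩]
  exact HurwitzZeta.hasSum_hurwitzZeta_of_one_lt_re ⟨hα.le, hα'⟩ hs

section LocalLog

/-!
Multiplying by `(s - 1) / (s + 1)` removes the possible pole, at the cost of the square integrable
term `log (1 + 2 / |t|)`. On `Re s > 0` the regularised function `G` is expressed through the Mellin
transform of the bounded remainder `S` in the summatory function of the coefficients. Plancherel
applied to `x ↦ S (e^h x) - S x` with `h ≍ 1 / T`, which is small on average because `S` has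
variation `O(1)` on every unit interval, bounds the mean square of `G` on each line `Re s > 1/2` by
`O(T)`.

It remains to pass from `G` to `log |G|`. Every segment of unit length on the line lies in a disc
whose centre is far enough to the right for the term `n = 0` to dominate `G`. Dividing off the
zeros and applying the Borel–Carathéodory inequality to the zero-free quotient, the mean square of
`log |G|` on the segment is `O(M ^ 2)`, where `M` is the maximum of `|G|` on a slightly larger disc,
and `M ^ 2` is at most a constant times the mean of `|G| ^ 2` on a square around that disc.
-/

open Complex Metric

theorem exists_differentiableOn_exp_eq_of_ne_zero {f : ℂ → ℂ} {c : ℂ} {R : ℝ} (hR : 0 < R)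
    (hf : DifferentiableOn ℂ f (ball c R)) (hf₀ : ∀ z ∈ ball c R, f z ≠ 0) :
    ∃ g : ℂ → ℂ, DifferentiableOn ℂ g (ball c R) ∧ ∀ z ∈ ball c R, exp (g z) = f z := by
  have hd : DifferentiableOn ℂ (fun z => deriv f z / f z) (ball c R) :=
    (hf.deriv isOpen_ball).div hf hf₀
  obtain ⟨g, hgc, hg⟩ := hd.isExactOn_ball.with_val_at c (log (f c))
  refine ⟨g, fun z hz => (hg z hz).differentiableAt.differentiableWithinAt, fun z hz => ?_⟩
  have hder : ∀ z ∈ ball c R, HasDerivAt (fun z => exp (-g z) * f z) 0 z := by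
    intro z hz
    convert! (hg z hz).neg.cexp.mul (hf.differentiableAt (isOpen_ball.mem_nhds hz)).hasDerivAt
      using 1
    have := hf₀ z hz
    field_simp
    ring
  have hconst := isOpen_ball.is_const_of_deriv_eq_zero (convex_ball c R).isPreconnected
    (fun z hz => (hder z hz).differentiableAt.differentiableWithinAt)
    (fun z hz => (hder z hz).deriv) hz (mem_ball_self hR)
  simp only [hgc, exp_neg, exp_log (hf₀ c (mem_ball_self hR))] at hconst
  rwa [inv_mul_cancel₀ (hf₀ c (mem_ball_self hR)), inv_mul_eq_one₀ (exp_ne_zero _)] at hconst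

theorem abs_log_norm_le_of_ne_zero {f : ℂ → ℂ} {R r M : ℝ} (hrR : r < R) (hM : 0 < M)
    (hf : DifferentiableOn ℂ f (ball 0 R)) (hf₀ : ∀ z ∈ ball (0 : ℂ) R, f z ≠ 0)
    (hf₁ : ∀ z ∈ ball (0 : ℂ) R, ‖f z‖ ≤ 1) (hfM : -M ≤ Real.log ‖f 0‖) {z : ℂ} (hz : ‖z‖ ≤ r) :
    |Real.log ‖f z‖| ≤ M * (1 + 2 * r / (R - r)) := by
  have hR : 0 < R := (norm_nonneg z).trans_lt (hz.trans_lt hrR)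
  have hzR : z ∈ ball (0 : ℂ) R := mem_ball_zero_iff.2 (hz.trans_lt hrR)
  obtain ⟨g, hg, hgf⟩ := exists_differentiableOn_exp_eq_of_ne_zero hR hf hf₀
  have hre : ∀ w ∈ ball (0 : ℂ) R, (g w).re = Real.log ‖f w‖ := by
    intro w hw
    rw [← hgf w hw, norm_exp, Real.log_exp]
  have hre_nonpos : ∀ w ∈ ball (0 : ℂ) R, (g w).re ≤ 0 := fun w hw =>
    (hre w hw).trans_le (Real.log_nonpos (norm_nonneg _) (hf₁ w hw))
  rw [← hre 0 (mem_ball_self hR)] at hfM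
  have hnorm : ‖g z - g 0‖ ≤ 2 * M * ‖z‖ / (R - ‖z‖) :=
    borelCaratheodory_zero (f := fun w => g w - g 0) hM (hg.sub_const _)
      (fun w hw => by
        simp only [Set.mem_ofPred_eq, sub_re]
        linarith [hre_nonpos w hw]) hR hzR (sub_self _)
  have hmono : 2 * M * ‖z‖ / (R - ‖z‖) ≤ 2 * M * r / (R - r) := by
    have : 0 < R - r := sub_pos.2 hrR
    have : 0 ≤ r := (norm_nonneg z).trans hz
    gcongr
  have hre_sub : -(g z - g 0).re ≤ ‖g z - g 0‖ := (neg_le_abs _).trans (abs_re_le_norm _)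
  rw [sub_re] at hre_sub
  rw [← hre z hzR, abs_of_nonpos (hre_nonpos z hzR)]
  calc -(g z).re ≤ M + 2 * M * r / (R - r) := by linarith
    _ = M * (1 + 2 * r / (R - r)) := by ring

theorem one_le_norm_canonicalFactor {R : ℝ} {ρ z : ℂ} (hρ : ‖ρ‖ < R) (hz : ‖z‖ ≤ R)
    (hzρ : z ≠ ρ) : 1 ≤ ‖canonicalFactor R ρ z‖ := by
  have hR : 0 < R := (norm_nonneg ρ).trans_lt hρ
  have hidentity : ‖(R : ℂ) ^ 2 - (starRingEnd ℂ) ρ * z‖ ^ 2 - (R * ‖z - ρ‖) ^ 2 =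
      (R ^ 2 - ‖z‖ ^ 2) * (R ^ 2 - ‖ρ‖ ^ 2) := by
    simp only [mul_pow, Complex.sq_norm, normSq_apply]
    simp [pow_two]
    ring
  have hz' : 0 ≤ R ^ 2 - ‖z‖ ^ 2 := sub_nonneg.2 (pow_le_pow_left₀ (norm_nonneg _) hz 2)
  have hρ' : 0 ≤ R ^ 2 - ‖ρ‖ ^ 2 := sub_nonneg.2 (pow_le_pow_left₀ (norm_nonneg _) hρ.le 2)
  have hden : 0 < R * ‖z - ρ‖ := mul_pos hR (norm_pos_iff.2 (sub_ne_zero.2 hzρ))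
  rw [canonicalFactor_apply, norm_div, norm_mul, Complex.norm_of_nonneg hR.le, one_le_div hden]
  exact le_of_sq_le_sq (by linarith [mul_nonneg hz' hρ']) (norm_nonneg _)

theorem norm_canonicalFactor_le {R : ℝ} {ρ z : ℂ} (hρ : ‖ρ‖ < R) (hz : ‖z‖ ≤ R) :
    ‖canonicalFactor R ρ z‖ ≤ 2 * R / ‖z - ρ‖ := by
  have hR : 0 < R := (norm_nonneg ρ).trans_lt hρ
  have hnum : ‖(R : ℂ) ^ 2 - (starRingEnd ℂ) ρ * z‖ ≤ R * (2 * R) := by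
    refine (norm_sub_le _ _).trans ?_
    rw [norm_pow, norm_mul, RCLike.norm_conj, Complex.norm_of_nonneg hR.le]
    nlinarith [mul_le_mul hρ.le hz (norm_nonneg _) hR.le]
  rw [canonicalFactor_apply, norm_div, norm_mul, Complex.norm_of_nonneg hR.le]
  calc ‖(R : ℂ) ^ 2 - (starRingEnd ℂ) ρ * z‖ / (R * ‖z - ρ‖)
      ≤ R * (2 * R) / (R * ‖z - ρ‖) := by gcongr
    _ = 2 * R / ‖z - ρ‖ := mul_div_mul_left _ _ hR.ne'

theorem exists_eq_mul_canonicalFactor {f : ℂ → ℂ} {R : ℝ} {ρ : ℂ} (hρ : ‖ρ‖ < R)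
    (hf : AnalyticOnNhd ℂ f (closedBall 0 R)) (hfρ : f ρ = 0) :
    ∃ g : ℂ → ℂ, AnalyticOnNhd ℂ g (closedBall 0 R) ∧
      ∀ z ≠ ρ, g z = f z * canonicalFactor R ρ z := by
  set U : Set ℂ := {z | AnalyticAt ℂ f z}
  have hUo : IsOpen U := isOpen_analyticAt ℂ f
  have hρU : U ∈ 𝓝 ρ := hUo.mem_nhds (hf ρ (mem_closedBall_zero_iff.2 hρ.le))
  have hdslope : DifferentiableOn ℂ (dslope f ρ) U :=
    (differentiableOn_dslope hρU).2 fun z hz => AnalyticAt.differentiableWithinAt hz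
  refine ⟨fun z => dslope f ρ z * (((R : ℂ) ^ 2 - (starRingEnd ℂ) ρ * z) / R), ?_, ?_⟩
  · exact (DifferentiableOn.analyticOnNhd (by fun_prop) hUo).mono hf
  · intro z hz
    simp only [dslope_of_ne _ hz, slope_def_field, hfρ, sub_zero, canonicalFactor_apply]
    field_simp

theorem norm_mul_canonicalFactor_le_one {f g : ℂ → ℂ} {R : ℝ} {ρ : ℂ} (hρ : ‖ρ‖ < R)
    (hg : AnalyticOnNhd ℂ g (closedBall 0 R))
    (hgf : ∀ z ≠ ρ, g z = f z * canonicalFactor R ρ z)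
    (hf₁ : ∀ z ∈ closedBall (0 : ℂ) R, ‖f z‖ ≤ 1) {z : ℂ} (hz : z ∈ closedBall (0 : ℂ) R) :
    ‖g z‖ ≤ 1 := by
  have hR : R ≠ 0 := ((norm_nonneg ρ).trans_lt hρ).ne'
  rw [← closure_ball (0 : ℂ) hR] at hz hg
  refine norm_le_of_forall_mem_frontier_norm_le isBounded_ball
    ⟨(hg.mono subset_closure).differentiableOn, hg.continuousOn⟩ (fun w hw => ?_) hz
  rw [frontier_ball (0 : ℂ) hR] at hw
  have hwρ : w ≠ ρ := by
    rintro rfl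
    exact hρ.ne (mem_sphere_zero_iff_norm.1 hw)
  rw [hgf w hwρ, norm_mul, norm_canonicalFactor_eval_circle_eq_one (mem_ball_zero_iff.2 hρ) hw,
    mul_one]
  exact hf₁ w (sphere_subset_closedBall hw)

theorem abs_log_norm_le_add_log_of_canonicalFactor {f g : ℂ → ℂ} {R : ℝ} {ρ z : ℂ}
    (hρ : ‖ρ‖ < R) (hz : ‖z‖ ≤ R) (hfρ : f ρ = 0)
    (hgf : ∀ z ≠ ρ, g z = f z * canonicalFactor R ρ z) :
    |Real.log ‖f z‖| ≤ |Real.log ‖g z‖| + Real.log (1 + 2 * R / ‖z - ρ‖) := by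
  obtain rfl | hzρ := eq_or_ne z ρ
  · simp [hfρ]
  have hge := one_le_norm_canonicalFactor hρ hz hzρ
  have hle : ‖canonicalFactor R ρ z‖ ≤ 1 + 2 * R / ‖z - ρ‖ :=
    (norm_canonicalFactor_le hρ hz).trans (le_add_of_nonneg_left zero_le_one)
  have hlog_nonneg := Real.log_nonneg hge
  have hlog_le := Real.log_le_log (one_pos.trans_le hge) hle
  obtain hfz | hfz := eq_or_ne (f z) 0
  · simpa [hgf z hzρ, hfz] using hlog_nonneg.trans hlog_le
  have hlog : Real.log ‖g z‖ = Real.log ‖f z‖ + Real.log ‖canonicalFactor R ρ z‖ := by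
    rw [hgf z hzρ, norm_mul, Real.log_mul (norm_ne_zero_iff.2 hfz) (one_pos.trans_le hge).ne']
  calc |Real.log ‖f z‖| = |Real.log ‖g z‖ - Real.log ‖canonicalFactor R ρ z‖| := by
        rw [hlog, add_sub_cancel_right]
    _ ≤ |Real.log ‖g z‖| + |Real.log ‖canonicalFactor R ρ z‖| := abs_sub _ _
    _ ≤ |Real.log ‖g z‖| + Real.log (1 + 2 * R / ‖z - ρ‖) := by
        rw [abs_of_nonneg hlog_nonneg]
        gcongr

theorem exists_dividing_zero {f : ℂ → ℂ} {R R' : ℝ} {ρ : ℂ} (hR : R' < R) (hρ : ‖ρ‖ < R')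
    (hf : AnalyticOnNhd ℂ f (closedBall 0 R)) (hf₁ : ∀ z ∈ closedBall (0 : ℂ) R, ‖f z‖ ≤ 1)
    (hfρ : f ρ = 0) :
    ∃ g : ℂ → ℂ, AnalyticOnNhd ℂ g (closedBall 0 R) ∧ (∀ z ∈ closedBall (0 : ℂ) R, ‖g z‖ ≤ 1) ∧
      ‖f 0‖ * (R / R') ≤ ‖g 0‖ ∧
      ∀ z ∈ closedBall (0 : ℂ) R,
        |Real.log ‖f z‖| ≤ |Real.log ‖g z‖| + Real.log (1 + 2 * R / ‖z - ρ‖) := by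
  have hρR : ‖ρ‖ < R := hρ.trans hR
  have hR0 : 0 < R := (norm_nonneg ρ).trans_lt hρR
  obtain ⟨g, hg, hgf⟩ := exists_eq_mul_canonicalFactor hρR hf hfρ
  refine ⟨g, hg, fun z => norm_mul_canonicalFactor_le_one hρR hg hgf hf₁, ?_, fun z hz =>
    abs_log_norm_le_add_log_of_canonicalFactor hρR (mem_closedBall_zero_iff.1 hz) hfρ hgf⟩
  obtain rfl | hρ0 := eq_or_ne ρ 0
  · simp [hfρ]
  have hfactor : ‖canonicalFactor R ρ 0‖ = R / ‖ρ‖ := by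
    simp [canonicalFactor_apply, abs_of_pos hR0]
    field_simp
  rw [hgf 0 hρ0.symm, norm_mul, hfactor]
  have := norm_pos_iff.2 hρ0
  gcongr

/- Each zero in `‖z‖ < R'` costs a factor `R / R'` in `‖f 0‖`, so that there are at most `k` of
them; dividing them off leaves a zero-free function. -/
theorem exists_multiset_abs_log_norm_le {r R' R : ℝ} (hrR' : r < R') (hR' : 0 < R')
    (hR : R' < R) (k : ℕ) {f : ℂ → ℂ} (hf : AnalyticOnNhd ℂ f (closedBall 0 R))
    (hf₁ : ∀ z ∈ closedBall (0 : ℂ) R, ‖f z‖ ≤ 1) (hk : (R' / R) ^ k ≤ ‖f 0‖) :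
    ∃ Z : Multiset ℂ, Z.card ≤ k ∧ ∀ z, ‖z‖ ≤ r →
      |Real.log ‖f z‖| ≤ (k + 1) * Real.log (R / R') * (1 + 2 * r / (R' - r)) +
        (Z.map fun ρ => Real.log (1 + 2 * R / ‖z - ρ‖)).sum := by
  have hR0 : 0 < R := hR'.trans hR
  have hq : 0 < Real.log (R / R') := Real.log_pos ((one_lt_div hR').2 hR)
  by_cases hzero : ∀ ρ ∈ ball (0 : ℂ) R', f ρ ≠ 0
  · have hsub : ball (0 : ℂ) R' ⊆ closedBall 0 R :=
      (ball_subset_ball hR.le).trans ball_subset_closedBall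
    have hlog : -((k + 1) * Real.log (R / R')) ≤ Real.log ‖f 0‖ := by
      have := Real.log_le_log (by positivity) hk
      rw [Real.log_pow, ← inv_div, Real.log_inv] at this
      linarith
    refine ⟨0, by simp, fun z hz => ?_⟩
    simpa using abs_log_norm_le_of_ne_zero hrR' (by positivity) (hf.mono hsub).differentiableOn
      hzero (fun w hw => hf₁ w (hsub hw)) hlog hz
  push Not at hzero
  obtain ⟨ρ, hρ, hfρ⟩ := hzero
  obtain ⟨g, hg, hg₁, hg0, hlog⟩ :=
    exists_dividing_zero hR (mem_ball_zero_iff.1 hρ) hf hf₁ hfρ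
  cases k with
  | zero =>
    have hlt : 1 < R / R' := (one_lt_div hR').2 hR
    have hle := hg₁ 0 (mem_closedBall_self hR0.le)
    rw [pow_zero] at hk
    nlinarith
  | succ k =>
    have hk' : (R' / R) ^ k ≤ ‖g 0‖ := by
      calc (R' / R) ^ k = (R' / R) ^ (k + 1) * (R / R') := by rw [pow_succ]; field_simp
        _ ≤ ‖f 0‖ * (R / R') := by gcongr
        _ ≤ ‖g 0‖ := hg0
    obtain ⟨Z, hZ, hgZ⟩ := exists_multiset_abs_log_norm_le hrR' hR' hR k hg hg₁ hk'
    refine ⟨ρ ::ₘ Z, by simpa using hZ, fun z hz => ?_⟩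
    have hr : 0 ≤ r := (norm_nonneg z).trans hz
    have hB : 0 ≤ Real.log (R / R') * (1 + 2 * r / (R' - r)) := by
      have : 0 < R' - r := sub_pos.2 hrR'
      positivity
    have hfz := hlog z (mem_closedBall_zero_iff.2 (hz.trans (hrR'.trans hR).le))
    rw [Multiset.map_cons, Multiset.sum_cons]
    push_cast
    linarith [hgZ z hz]

theorem exists_nat_pow_le_div {R R' c : ℝ} (hR' : 0 < R') (hR : R' < R) (hc : 0 < c) :
    ∃ D : ℝ, 0 ≤ D ∧ ∀ M : ℝ, 1 ≤ M → ∃ k : ℕ, (R' / R) ^ k ≤ c / M ∧ (k : ℝ) + 1 ≤ D * M := by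
  have hR0 : 0 < R := hR'.trans hR
  set q := Real.log (R / R')
  have hq0 : 0 < q := Real.log_pos ((one_lt_div hR').2 hR)
  refine ⟨1 / (c * q) + 2, by positivity, fun M hM => ⟨⌈Real.log (M / c) / q⌉₊, ?_, ?_⟩⟩
  · have : 0 < M := one_pos.trans_le hM
    have hceil := (div_le_iff₀ hq0).1 (Nat.le_ceil (Real.log (M / c) / q))
    rw [← Real.log_le_log_iff (by positivity) (by positivity), Real.log_pow, ← inv_div R R',
      Real.log_inv, ← inv_div M c, Real.log_inv]
    linarith
  · have : 0 < M := one_pos.trans_le hM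
    have hlog : Real.log (M / c) / q ≤ M / c / q := by
      gcongr
      exact Real.log_le_self (by positivity)
    have hceil := (Nat.cast_le.2 (Nat.ceil_mono hlog)).trans
      (Nat.ceil_lt_add_one (R := ℝ) (by positivity)).le
    calc (⌈Real.log (M / c) / q⌉₊ : ℝ) + 1 ≤ M / c / q + 2 * M := by linarith
      _ = (1 / (c * q) + 2) * M := by field_simp

theorem abs_log_le_abs_log_div_add {x M : ℝ} (hx : 0 ≤ x) (hM : 1 ≤ M) :
    |Real.log x| ≤ |Real.log (x / M)| + M := by
  have hM0 : 0 < M := one_pos.trans_le hM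
  obtain rfl | hx0 := hx.eq_or_lt
  · simpa using hM0.le
  have htriangle := abs_add_le (Real.log x - Real.log M) (Real.log M)
  rw [sub_add_cancel, abs_of_nonneg (Real.log_nonneg hM)] at htriangle
  rw [Real.log_div hx0.ne' hM0.ne']
  linarith [Real.log_le_self hM0.le]

theorem exists_multiset_abs_log_norm_le_of_le_norm {r R c : ℝ} (hr : 0 ≤ r) (hrR : r < R)
    (hc : 0 < c) :
    ∃ D : ℝ, 0 ≤ D ∧ ∀ {G : ℂ → ℂ} {w : ℂ} {M : ℝ}, AnalyticOnNhd ℂ G (closedBall w R) →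
      1 ≤ M → (∀ z ∈ closedBall w R, ‖G z‖ ≤ M) → c ≤ ‖G w‖ →
      ∃ Z : Multiset ℂ, Z.card ≤ D * M ∧ ∀ z ∈ closedBall w r,
        |Real.log ‖G z‖| ≤ D * M + (Z.map fun ρ => Real.log (1 + 2 * R / ‖z - ρ‖)).sum := by
  obtain ⟨R', hrR', hR⟩ := exists_between hrR
  have hR' : 0 < R' := hr.trans_lt hrR'
  obtain ⟨D, hD, hk⟩ := exists_nat_pow_le_div hR' hR hc
  set B := Real.log (R / R') * (1 + 2 * r / (R' - r))
  have hB0 : 0 ≤ B := by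
    have := Real.log_nonneg ((one_le_div hR').2 hR.le)
    have : 0 < R' - r := sub_pos.2 hrR'
    positivity
  refine ⟨D * (1 + B) + 1, by positivity, fun {G w M} hG hM hGM hGw => ?_⟩
  have hM0 : 0 < M := one_pos.trans_le hM
  obtain ⟨k, hkc, hkM⟩ := hk M hM
  set f : ℂ → ℂ := fun z => G (w + z) / M
  have hmaps : ∀ z ∈ closedBall (0 : ℂ) R, w + z ∈ closedBall w R := fun z hz => by
    simpa using hz
  have hf : AnalyticOnNhd ℂ f (closedBall 0 R) := fun z hz =>
    ((hG _ (hmaps z hz)).comp (f := fun z => w + z) (by fun_prop)).div analyticAt_const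
      (by exact_mod_cast hM0.ne')
  have hnorm : ∀ z, ‖f z‖ = ‖G (w + z)‖ / M := fun z => by
    rw [norm_div, Complex.norm_of_nonneg hM0.le]
  obtain ⟨Z, hZ, hfZ⟩ := exists_multiset_abs_log_norm_le hrR' hR' hR k hf
    (fun z hz => by rw [hnorm, div_le_one hM0]; exact hGM _ (hmaps z hz))
    (hkc.trans (by rw [hnorm, add_zero]; gcongr))
  have hDBM : 0 ≤ D * B * M := by positivity
  refine ⟨Z.map (w + ·), ?_, fun z hz => ?_⟩
  · rw [Multiset.card_map]
    linarith [(Nat.cast_le (α := ℝ)).2 hZ]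
  · have hlogf := hfZ (z - w) (by simpa [dist_eq_norm] using hz)
    rw [hnorm, add_sub_cancel] at hlogf
    have hscale := abs_log_le_abs_log_div_add (norm_nonneg (G z)) hM
    have hkB : (k + 1) * B ≤ D * M * B := by gcongr
    have hDM : 0 ≤ D * M := by positivity
    simp only [Multiset.map_map, Function.comp_def, ← sub_sub]
    rw [mul_assoc] at hlogf
    linarith

end LocalLog

section LogSingularity

open MeasureTheory Set
open scoped ENNReal

theorem integrableOn_abs_rpow_neg_half :
    IntegrableOn (fun u : ℝ => |u| ^ (-(1 / 2) : ℝ)) (Icc (-1) 1) := by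
  have hpos : IntervalIntegrable (fun u : ℝ => |u| ^ (-(1 / 2) : ℝ)) volume 0 1 := by
    refine (intervalIntegral.intervalIntegrable_rpow' (r := -(1 / 2)) (by norm_num)).congr ?_
    intro x hx
    rw [uIoc_of_le zero_le_one] at hx
    simp only [abs_of_pos hx.1]
  have hneg : IntervalIntegrable (fun u : ℝ => |u| ^ (-(1 / 2) : ℝ)) volume (-1) 0 := by
    simpa using ((IntervalIntegrable.iff_comp_neg).1 hpos).symm
  have := hneg.trans hpos
  rwa [intervalIntegrable_iff_integrableOn_Icc_of_le (by norm_num)] at this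

theorem sq_log_one_add_le {x : ℝ} (hx : 0 ≤ x) :
    Real.log (1 + x) ^ 2 ≤ 16 * (1 + x) ^ (1 / 2 : ℝ) := by
  have hx1 : 0 ≤ 1 + x := by positivity
  have hlog : 0 ≤ Real.log (1 + x) := Real.log_nonneg (le_add_of_nonneg_right hx)
  calc Real.log (1 + x) ^ 2 ≤ ((1 + x) ^ (1 / 4 : ℝ) / (1 / 4)) ^ 2 := by
        gcongr
        exact Real.log_le_rpow_div hx1 (by norm_num)
    _ = 16 * (1 + x) ^ (1 / 2 : ℝ) := by
        rw [div_pow, ← Real.rpow_natCast, ← Real.rpow_mul hx1]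
        norm_num
        ring

theorem sq_log_one_add_div_abs_le {C : ℝ} (hC : 0 ≤ C) (u : ℝ) :
    Real.log (1 + C / |u|) ^ 2 ≤ 16 * (1 + C) ^ (1 / 2 : ℝ) *
      (1 + (Icc (-1 : ℝ) 1).indicator (fun u => |u| ^ (-(1 / 2) : ℝ)) u) := by
  have hsq := sq_log_one_add_le (show 0 ≤ C / |u| by positivity)
  by_cases hu : u ∈ Icc (-1 : ℝ) 1
  · rw [indicator_of_mem hu]
    obtain rfl | hu0 := eq_or_ne u 0
    · simp only [abs_zero, div_zero, add_zero, Real.log_one, zero_pow two_ne_zero]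
      positivity
    have hpos : 0 < |u| := abs_pos.2 hu0
    calc Real.log (1 + C / |u|) ^ 2 ≤ 16 * (1 + C / |u|) ^ (1 / 2 : ℝ) := hsq
      _ ≤ 16 * ((1 + C) / |u|) ^ (1 / 2 : ℝ) := by
          rw [add_div]
          gcongr
          exact (one_le_div hpos).2 (abs_le.2 hu)
      _ = 16 * (1 + C) ^ (1 / 2 : ℝ) * |u| ^ (-(1 / 2) : ℝ) := by
          rw [Real.div_rpow (by positivity) hpos.le, Real.rpow_neg hpos.le]
          ring
      _ ≤ _ := by
          gcongr
          exact le_add_of_nonneg_left zero_le_one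
  · rw [indicator_of_notMem hu, add_zero, mul_one]
    have hone : 1 ≤ |u| := by
      rw [mem_Icc, ← abs_le, not_le] at hu
      exact hu.le
    refine hsq.trans ?_
    gcongr
    exact div_le_self hC hone

theorem exists_setLIntegral_sq_log_one_add_div_le {C : ℝ} (hC : 0 ≤ C) :
    ∃ K : ℝ≥0∞, K ≠ ∞ ∧ ∀ (b : ℝ) (A : Set ℝ),
      ∫⁻ t in A, ‖Real.log (1 + C / |t - b|)‖ₑ ^ 2 ≤ K * (1 + volume A) := by
  set φ : ℝ → ℝ≥0∞ := (Icc (-1 : ℝ) 1).indicator fun u => ENNReal.ofReal (|u| ^ (-(1 / 2) : ℝ))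
  have hφm : Measurable φ := by fun_prop (disch := measurability)
  have hφ : ∫⁻ u, φ u ≠ ∞ := by
    rw [lintegral_indicator measurableSet_Icc]
    exact integrableOn_abs_rpow_neg_half.lintegral_lt_top.ne
  set c : ℝ≥0∞ := ENNReal.ofReal (16 * (1 + C) ^ (1 / 2 : ℝ))
  have hpt : ∀ u : ℝ, ‖Real.log (1 + C / |u|)‖ₑ ^ 2 ≤ c * (1 + φ u) := by
    intro u
    have hind : 0 ≤ (Icc (-1 : ℝ) 1).indicator (fun u => |u| ^ (-(1 / 2) : ℝ)) u :=
      indicator_nonneg (fun _ _ => by positivity) u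
    have hφu : φ u = ENNReal.ofReal
        ((Icc (-1 : ℝ) 1).indicator (fun u => |u| ^ (-(1 / 2) : ℝ)) u) := by
      by_cases hu : u ∈ Icc (-1 : ℝ) 1 <;> simp [φ, hu]
    rw [hφu, ← ENNReal.ofReal_one, ← ENNReal.ofReal_add zero_le_one hind,
      ← ENNReal.ofReal_mul (by positivity), ← enorm_pow, Real.enorm_of_nonneg (sq_nonneg _)]
    exact ENNReal.ofReal_le_ofReal (sq_log_one_add_div_abs_le hC u)
  refine ⟨c * (1 + ∫⁻ u, φ u), by finiteness, fun b A => ?_⟩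
  calc ∫⁻ t in A, ‖Real.log (1 + C / |t - b|)‖ₑ ^ 2
      ≤ ∫⁻ t in A, c * (1 + φ (t - b)) := lintegral_mono fun t => hpt (t - b)
    _ = c * (volume A + ∫⁻ t in A, φ (t - b)) := by
        rw [lintegral_const_mul _ (by fun_prop), lintegral_add_left measurable_const,
          setLIntegral_one]
    _ ≤ c * (volume A + ∫⁻ u, φ u) := by
        gcongr c * (volume A + ?_)
        exact (setLIntegral_le_lintegral A _).trans (lintegral_sub_right_eq_self φ b).le
    _ ≤ c * (1 + ∫⁻ u, φ u) * (1 + volume A) := by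
        rw [mul_assoc]
        gcongr
        calc volume A + ∫⁻ u, φ u ≤ (volume A + ∫⁻ u, φ u) + (1 + (∫⁻ u, φ u) * volume A) :=
              le_self_add
          _ = (1 + ∫⁻ u, φ u) * (1 + volume A) := by ring

end LogSingularity

section LogSegment

open MeasureTheory Set
open scoped ENNReal

variable {α ι E : Type*} [MeasurableSpace α] {μ : Measure α} [NormedAddCommGroup E]

theorem aestronglyMeasurable_sum_map {φ : ι → α → E} (hφ : ∀ i, AEStronglyMeasurable (φ i) μ)
    (Z : Multiset ι) : AEStronglyMeasurable (fun x => (Z.map fun i => φ i x).sum) μ := by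
  simpa [Multiset.map_map] using
    Multiset.aestronglyMeasurable_fun_sum (Z.map φ) (by simpa using fun i _ => hφ i)

theorem eLpNorm_sum_map_le {p K : ℝ≥0∞} (hp : 1 ≤ p) {φ : ι → α → E}
    (hφ : ∀ i, AEStronglyMeasurable (φ i) μ) (hK : ∀ i, eLpNorm (φ i) p μ ≤ K) (Z : Multiset ι) :
    eLpNorm (fun x => (Z.map fun i => φ i x).sum) p μ ≤ Z.card * K := by
  induction Z using Multiset.induction with
  | empty => simp
  | cons i Z ih =>
    simp only [Multiset.map_cons, Multiset.sum_cons, Multiset.card_cons, Nat.cast_add,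
      Nat.cast_one, add_mul, one_mul]
    refine (eLpNorm_add_le (hφ i) (aestronglyMeasurable_sum_map hφ Z) hp).trans ?_
    rw [add_comm]
    exact add_le_add ih (hK i)

theorem eLpNorm_two_sq (f : α → E) : eLpNorm f 2 μ ^ 2 = ∫⁻ x, ‖f x‖ₑ ^ 2 ∂μ := by
  simpa using eLpNorm_nnreal_pow_eq_lintegral (f := f) (μ := μ) (p := 2) two_ne_zero

theorem enorm_log_one_add_div_norm_le {C t : ℝ} (hC : 0 ≤ C) (x ρ : ℂ) (ht : t ≠ ρ.im - x.im) :
    ‖Real.log (1 + C / ‖x + t * Complex.I - ρ‖)‖ₑ ≤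
      ‖Real.log (1 + C / |t - (ρ.im - x.im)|)‖ₑ := by
  have : 0 < |t - (ρ.im - x.im)| := abs_pos.2 (sub_ne_zero.2 ht)
  have hle : |t - (ρ.im - x.im)| ≤ ‖x + t * Complex.I - ρ‖ := by
    refine le_trans (le_of_eq ?_) (Complex.abs_im_le_norm _)
    congr 1
    simp
    ring
  have hlog : ∀ {y : ℝ}, 0 ≤ y → 0 ≤ Real.log (1 + C / y) := fun hy =>
    Real.log_nonneg (le_add_of_nonneg_right (by positivity))
  rw [Real.enorm_of_nonneg (hlog (norm_nonneg _)), Real.enorm_of_nonneg (hlog (abs_nonneg _))]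
  gcongr

theorem exists_eLpNorm_log_one_add_div_norm_le {C : ℝ} (hC : 0 ≤ C) :
    ∃ K : ℝ≥0∞, K ≠ ∞ ∧ ∀ x ρ : ℂ,
      eLpNorm (fun t : ℝ => Real.log (1 + C / ‖x + t * Complex.I - ρ‖)) 2
        (volume.restrict (Icc 0 1)) ≤ K := by
  obtain ⟨K, hK, hlog⟩ := exists_setLIntegral_sq_log_one_add_div_le hC
  refine ⟨1 + 2 * K, by finiteness, fun x ρ => (ENNReal.pow_le_pow_left_iff two_ne_zero).1 ?_⟩
  rw [eLpNorm_two_sq]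
  calc ∫⁻ t in Icc (0 : ℝ) 1, ‖Real.log (1 + C / ‖x + t * Complex.I - ρ‖)‖ₑ ^ 2
      ≤ ∫⁻ t in Icc (0 : ℝ) 1, ‖Real.log (1 + C / |t - (ρ.im - x.im)|)‖ₑ ^ 2 :=
        lintegral_mono_ae ((Measure.ae_ne _ _).mono fun t ht =>
          pow_le_pow_left₀ zero_le (enorm_log_one_add_div_norm_le hC x ρ ht) 2)
    _ ≤ K * (1 + volume (Icc (0 : ℝ) 1)) := hlog _ _
    _ ≤ K * (1 + 1) + (1 + 2 * K + 4 * K ^ 2) := by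
        rw [Real.volume_Icc, sub_zero, ENNReal.ofReal_one]
        exact le_self_add
    _ = (1 + 2 * K) ^ 2 := by ring

open Metric in
theorem exists_setLIntegral_sq_log_norm_le {r R c : ℝ} (hr : 0 ≤ r) (hrR : r < R) (hc : 0 < c) :
    ∃ D : ℝ≥0∞, D ≠ ∞ ∧ ∀ {G : ℂ → ℂ} {w : ℂ} {M : ℝ}, AnalyticOnNhd ℂ G (closedBall w R) →
      1 ≤ M → (∀ z ∈ closedBall w R, ‖G z‖ ≤ M) → c ≤ ‖G w‖ → ∀ x : ℂ,
      (∀ t ∈ Icc (0 : ℝ) 1, x + t * Complex.I ∈ closedBall w r) →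
      ∫⁻ t in Icc (0 : ℝ) 1, ‖Real.log ‖G (x + t * Complex.I)‖‖ₑ ^ 2 ≤
        D * ENNReal.ofReal (M ^ 2) := by
  obtain ⟨D, hD, hZ⟩ := exists_multiset_abs_log_norm_le_of_le_norm hr hrR hc
  obtain ⟨K, hK, hlog⟩ := exists_eLpNorm_log_one_add_div_norm_le (C := 2 * R) (by linarith)
  refine ⟨(ENNReal.ofReal D * (1 + K)) ^ 2, by finiteness, fun {G w M} hG hM hGM hGw x hx => ?_⟩
  obtain ⟨Z, hZcard, hGZ⟩ := hZ hG hM hGM hGw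
  have hDM : 0 ≤ D * M := by positivity
  set μ : Measure ℝ := volume.restrict (Icc 0 1)
  set φ : ℂ → ℝ → ℝ := fun ρ t => Real.log (1 + 2 * R / ‖x + t * Complex.I - ρ‖)
  have hφm : ∀ ρ, AEStronglyMeasurable (φ ρ) μ := fun ρ =>
    Measurable.aestronglyMeasurable (by fun_prop)
  have hpt : ∀ᵐ t : ℝ ∂μ, ‖Real.log ‖G (x + t * Complex.I)‖‖ ≤
      D * M + (Z.map fun ρ => φ ρ t).sum := by
    filter_upwards [ae_restrict_mem measurableSet_Icc] with t ht using hGZ _ (hx t ht)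
  rw [← eLpNorm_two_sq]
  calc eLpNorm (fun t : ℝ => Real.log ‖G (x + t * Complex.I)‖) 2 μ ^ 2
      ≤ (eLpNorm (fun _ => D * M) 2 μ + eLpNorm (fun t => (Z.map fun ρ => φ ρ t).sum) 2 μ) ^ 2 := by
        gcongr
        exact (eLpNorm_mono_ae_real hpt).trans (eLpNorm_add_le aestronglyMeasurable_const
          (aestronglyMeasurable_sum_map hφm Z) one_le_two)
    _ ≤ (ENNReal.ofReal (D * M) + ENNReal.ofReal (D * M) * K) ^ 2 := by
        gcongr
        · rw [eLpNorm_const _ two_ne_zero (by simp [μ])]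
          simp [μ, Real.enorm_of_nonneg hDM]
        · refine (eLpNorm_sum_map_le one_le_two hφm (fun ρ => hlog x ρ) Z).trans ?_
          gcongr
          rw [← ENNReal.ofReal_natCast]
          exact ENNReal.ofReal_le_ofReal hZcard
    _ = (ENNReal.ofReal D * (1 + K)) ^ 2 * ENNReal.ofReal (M ^ 2) := by
        rw [ENNReal.ofReal_mul hD, ENNReal.ofReal_pow (zero_le_one.trans hM)]
        ring

end LogSegment

section MeanValue

open MeasureTheory Set Metric
open scoped ENNReal Real

theorem two_pi_mul_enorm_le_lintegral_circleMap {E : Type*} [NormedAddCommGroup E]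
    [NormedSpace ℂ E] [CompleteSpace E] {f : ℂ → E} {z : ℂ} {r : ℝ} (hr : 0 < r)
    (hf : DifferentiableOn ℂ f (closedBall z r)) :
    ENNReal.ofReal (2 * π) * ‖f z‖ₑ ≤ ∫⁻ θ in Ioo (-π) π, ‖f (circleMap z r θ)‖ₑ := by
  have hdiff : DiffContOnCl ℂ f (ball z |r|) := by
    rw [abs_of_pos hr]
    exact hf.diffContOnCl_ball subset_rfl
  have hmean : ∫ θ in (-π)..π, f (circleMap z r θ) = (2 * π) • f z := by
    have hper : Function.Periodic (fun θ => f (circleMap z r θ)) (2 * π) :=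
      (periodic_circleMap z r).comp f
    rw [← hdiff.circleAverage, Real.circleAverage_def, smul_inv_smul₀ (by positivity)]
    convert hper.intervalIntegral_add_eq (-π) 0 using 2 <;> ring
  rw [intervalIntegral.integral_of_le (by linarith [Real.pi_pos]), integral_Ioc_eq_integral_Ioo]
    at hmean
  rw [← Real.enorm_of_nonneg (by positivity), ← enorm_smul, ← hmean]
  exact enorm_integral_le_lintegral_enorm _

theorem lintegral_eq_lintegral_circleMap {F : ℂ → ℝ≥0∞} (hF : Measurable F) (z : ℂ) :
    ∫⁻ w, F w = ∫⁻ r in Ioi 0, ∫⁻ θ in Ioo (-π) π, ENNReal.ofReal r * F (circleMap z r θ) := by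
  have hpolar : ∀ p : ℝ × ℝ, z + Complex.polarCoord.symm p = circleMap z p.1 p.2 := fun p => by
    rw [Complex.polarCoord_symm_apply, circleMap, Complex.exp_mul_I, Complex.ofReal_cos,
      Complex.ofReal_sin]
  have hm : Measurable fun p : ℝ × ℝ => ENNReal.ofReal p.1 * F (circleMap z p.1 p.2) := by
    simp only [circleMap]
    fun_prop
  rw [← lintegral_add_left_eq_self _ z, ← Complex.lintegral_comp_polarCoord_symm,
    polarCoord_target, Measure.volume_eq_prod]
  simp only [hpolar, smul_eq_mul]
  exact setLIntegral_prod _ hm.aemeasurable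

theorem pi_mul_sq_mul_enorm_le_lintegral_closedBall {E : Type*} [NormedAddCommGroup E]
    [NormedSpace ℂ E] [CompleteSpace E] {f : ℂ → E} (hm : Measurable fun z => ‖f z‖ₑ) {z : ℂ}
    {δ : ℝ} (hδ : 0 ≤ δ) (hf : DifferentiableOn ℂ f (closedBall z δ)) :
    ENNReal.ofReal (π * δ ^ 2) * ‖f z‖ₑ ≤ ∫⁻ w in closedBall z δ, ‖f w‖ₑ := by
  set F : ℂ → ℝ≥0∞ := (closedBall z δ).indicator fun w => ‖f w‖ₑ
  have hcircle : ∀ r ∈ Ioc 0 δ, ENNReal.ofReal (2 * π * r) * ‖f z‖ₑ ≤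
      ∫⁻ θ in Ioo (-π) π, ENNReal.ofReal r * F (circleMap z r θ) := fun r hr => by
    have hF : ∀ θ, F (circleMap z r θ) = ‖f (circleMap z r θ)‖ₑ := fun θ =>
      indicator_of_mem (closedBall_subset_closedBall hr.2 (circleMap_mem_closedBall z hr.1.le θ)) _
    simp only [hF]
    rw [lintegral_const_mul' _ _ ENNReal.ofReal_ne_top, mul_comm (2 * π),
      ENNReal.ofReal_mul hr.1.le, mul_assoc]
    gcongr
    exact two_pi_mul_enorm_le_lintegral_circleMap hr.1
      (hf.mono (closedBall_subset_closedBall hr.2))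
  have harea : ∫⁻ r in Ioc 0 δ, ENNReal.ofReal (2 * π * r) = ENNReal.ofReal (π * δ ^ 2) := by
    rw [← ofReal_integral_eq_lintegral_ofReal
      ((continuous_const_mul (2 * π)).integrableOn_Icc.mono_set Ioc_subset_Icc_self)
      ((ae_restrict_mem measurableSet_Ioc).mono fun r hr => mul_nonneg (by positivity) hr.1.le),
      ← intervalIntegral.integral_of_le hδ, intervalIntegral.integral_const_mul, integral_id]
    ring_nf
  calc ENNReal.ofReal (π * δ ^ 2) * ‖f z‖ₑ
      = ∫⁻ r in Ioc 0 δ, ENNReal.ofReal (2 * π * r) * ‖f z‖ₑ := by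
        rw [lintegral_mul_const _ (by fun_prop), harea]
    _ ≤ ∫⁻ r in Ioc 0 δ, ∫⁻ θ in Ioo (-π) π, ENNReal.ofReal r * F (circleMap z r θ) :=
        setLIntegral_mono' measurableSet_Ioc hcircle
    _ ≤ ∫⁻ r in Ioi 0, ∫⁻ θ in Ioo (-π) π, ENNReal.ofReal r * F (circleMap z r θ) :=
        lintegral_mono_set Ioc_subset_Ioi_self
    _ = ∫⁻ w in closedBall z δ, ‖f w‖ₑ := by
        rw [← lintegral_eq_lintegral_circleMap (hm.indicator measurableSet_closedBall),
          lintegral_indicator measurableSet_closedBall]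

theorem setLIntegral_closedBall_le_lintegral_square {F : ℂ → ℝ≥0∞} (hF : Measurable F) (w : ℂ)
    (ρ : ℝ) : ∫⁻ z in closedBall w ρ, F z ≤
      ∫⁻ x in Icc (-ρ) ρ, ∫⁻ u in Icc (-ρ) ρ, F (w + (x + u * Complex.I)) := by
  have hpre : (w + ·) ⁻¹' closedBall w ρ ⊆
      Complex.measurableEquivRealProd ⁻¹' (Icc (-ρ) ρ ×ˢ Icc (-ρ) ρ) := fun z hz => by
    rw [mem_preimage, mem_closedBall, dist_self_add_left] at hz
    exact ⟨abs_le.1 ((Complex.abs_re_le_norm z).trans hz),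
      abs_le.1 ((Complex.abs_im_le_norm z).trans hz)⟩
  have hG : Measurable fun p : ℝ × ℝ => F (w + (p.1 + p.2 * Complex.I)) := by fun_prop
  calc ∫⁻ z in closedBall w ρ, F z
      = ∫⁻ z in (w + ·) ⁻¹' closedBall w ρ, F (w + z) :=
        ((measurePreserving_add_left volume w).setLIntegral_comp_preimage
          measurableSet_closedBall hF).symm
    _ ≤ ∫⁻ z in Complex.measurableEquivRealProd ⁻¹' (Icc (-ρ) ρ ×ˢ Icc (-ρ) ρ), F (w + z) :=
        lintegral_mono_set hpre
    _ = ∫⁻ p in Icc (-ρ) ρ ×ˢ Icc (-ρ) ρ, F (w + (p.1 + p.2 * Complex.I)) := by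
        rw [← Complex.volume_preserving_equiv_real_prod.setLIntegral_comp_preimage
          (measurableSet_Icc.prod measurableSet_Icc) hG]
        simp only [Complex.measurableEquivRealProd_apply, Complex.re_add_im]
    _ = ∫⁻ x in Icc (-ρ) ρ, ∫⁻ u in Icc (-ρ) ρ, F (w + (x + u * Complex.I)) := by
        rw [Measure.volume_eq_prod, setLIntegral_prod _ hG.aemeasurable]

theorem pi_mul_sq_mul_enorm_le_lintegral_square {E : Type*} [NormedAddCommGroup E]
    [NormedSpace ℂ E] [CompleteSpace E] {f : ℂ → E} (hm : Measurable fun z => ‖f z‖ₑ) {w z : ℂ}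
    {R δ : ℝ} (hδ : 0 ≤ δ) (hf : DifferentiableOn ℂ f (closedBall w (R + δ)))
    (hz : z ∈ closedBall w R) :
    ENNReal.ofReal (π * δ ^ 2) * ‖f z‖ₑ ≤
      ∫⁻ x in Icc (-(R + δ)) (R + δ), ∫⁻ u in Icc (-(R + δ)) (R + δ),
        ‖f (w + (x + u * Complex.I))‖ₑ := by
  have hsub : closedBall z δ ⊆ closedBall w (R + δ) :=
    closedBall_subset_closedBall' (by linarith [mem_closedBall.1 hz])
  calc ENNReal.ofReal (π * δ ^ 2) * ‖f z‖ₑ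
      ≤ ∫⁻ v in closedBall z δ, ‖f v‖ₑ :=
        pi_mul_sq_mul_enorm_le_lintegral_closedBall hm hδ (hf.mono hsub)
    _ ≤ ∫⁻ v in closedBall w (R + δ), ‖f v‖ₑ := lintegral_mono_set hsub
    _ ≤ _ := setLIntegral_closedBall_le_lintegral_square hm w (R + δ)

end MeanValue

section Windows

open MeasureTheory Set
open scoped ENNReal

theorem setLIntegral_Icc_comp_add_right (F : ℝ → ℝ≥0∞) (a b u : ℝ) :
    ∫⁻ y in Icc a b, F (y + u) = ∫⁻ y in Icc (a + u) (b + u), F y := by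
  rw [(measurePreserving_add_right volume u).setLIntegral_comp_emb
    (measurableEmbedding_addRight u), image_add_const_Icc]

theorem lintegral_Icc_lintegral_Icc_add_le {F : ℝ → ℝ≥0∞} (hF : Measurable F) (a b c d : ℝ) :
    ∫⁻ y in Icc a b, ∫⁻ u in Icc c d, F (y + u) ≤
      ENNReal.ofReal (d - c) * ∫⁻ t in Icc (a + c) (b + d), F t := by
  rw [lintegral_lintegral_swap (Measurable.aemeasurable (by fun_prop)), mul_comm,
    ← Real.volume_Icc, ← setLIntegral_const]
  refine setLIntegral_mono' measurableSet_Icc fun u hu => ?_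
  rw [setLIntegral_Icc_comp_add_right]
  exact lintegral_mono_set (Icc_subset_Icc (by linarith [hu.1]) (by linarith [hu.2]))

theorem lintegral_Icc_le_lintegral_Icc_lintegral_add {F : ℝ → ℝ≥0∞} (hF : Measurable F)
    (a b : ℝ) :
    ∫⁻ t in Icc a b, F t ≤ ∫⁻ y in Icc (a - 1) b, ∫⁻ u in Icc (0 : ℝ) 1, F (y + u) := by
  rw [lintegral_lintegral_swap (Measurable.aemeasurable (by fun_prop))]
  calc ∫⁻ t in Icc a b, F t = ∫⁻ _ in Icc (0 : ℝ) 1, ∫⁻ t in Icc a b, F t := by simp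
    _ ≤ ∫⁻ u in Icc (0 : ℝ) 1, ∫⁻ y in Icc (a - 1) b, F (y + u) := by
        refine setLIntegral_mono' measurableSet_Icc fun u hu => ?_
        rw [setLIntegral_Icc_comp_add_right]
        exact lintegral_mono_set (Icc_subset_Icc (by linarith [hu.2]) (by linarith [hu.1]))

end Windows

section MeanSquare

open MeasureTheory Set Metric
open scoped ENNReal Real

/-- The mean square of `f` over the vertical segments `[σ - iT, σ + iT]` is `O(T)` as `T → ∞`,
uniformly for `σ` in compact subsets of `(a, ∞)`. -/
def MeanSquareBounded {E : Type*} [NormedAddCommGroup E] (f : ℂ → E) (a : ℝ) : Prop :=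
  ∀ α β : ℝ, a < α → ∃ C : ℝ≥0∞, C ≠ ∞ ∧ ∀ T : ℝ, 1 ≤ T → ∀ σ ∈ Icc α β,
    ∫⁻ t in Icc (-T) T, ‖f (σ + t * Complex.I)‖ₑ ^ 2 ≤ C * ENNReal.ofReal T

namespace MeanSquareBounded

theorem exists_lintegral_rectangle_le {E : Type*} [NormedAddCommGroup E] [MeasurableSpace E]
    [OpensMeasurableSpace E] {f : ℂ → E} {a : ℝ} (h : MeanSquareBounded f a)
    (hf : Measurable f) {σ₀ ρ : ℝ} (hρ : a < σ₀ - ρ) (hρ0 : 0 ≤ ρ) :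
    ∃ C : ℝ≥0∞, C ≠ ∞ ∧ ∀ T : ℝ, 1 ≤ T →
      ∫⁻ y in Icc (-T) T, ∫⁻ x in Icc (-ρ) ρ, ∫⁻ u in Icc (-ρ) ρ,
        ‖f (↑(σ₀ + x) + ↑(y + u) * Complex.I)‖ₑ ^ 2 ≤ C * ENNReal.ofReal T := by
  obtain ⟨C, hC, hle⟩ := h (σ₀ - ρ) (σ₀ + ρ) hρ
  refine ⟨ENNReal.ofReal (2 * ρ) * (C * ENNReal.ofReal (1 + ρ)) * ENNReal.ofReal (2 * ρ),
    by finiteness, fun T hT => ?_⟩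
  have hT' : T + ρ ≤ (1 + ρ) * T := by nlinarith
  rw [lintegral_lintegral_swap (Measurable.aemeasurable (by fun_prop))]
  calc ∫⁻ x in Icc (-ρ) ρ, ∫⁻ y in Icc (-T) T, ∫⁻ u in Icc (-ρ) ρ,
        ‖f (↑(σ₀ + x) + ↑(y + u) * Complex.I)‖ₑ ^ 2
      ≤ ∫⁻ _ in Icc (-ρ) ρ,
          ENNReal.ofReal (2 * ρ) * (C * ENNReal.ofReal ((1 + ρ) * T)) := by
        refine setLIntegral_mono' measurableSet_Icc fun x hx => ?_
        refine (lintegral_Icc_lintegral_Icc_add_le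
          (F := fun t => ‖f (↑(σ₀ + x) + t * Complex.I)‖ₑ ^ 2) (by fun_prop) _ _ _ _).trans ?_
        rw [← neg_add, sub_neg_eq_add, ← two_mul]
        gcongr
        refine (hle (T + ρ) (by linarith) (σ₀ + x)
          ⟨by linarith [hx.1], by linarith [hx.2]⟩).trans ?_
        gcongr
    _ = _ := by
        rw [setLIntegral_const, Real.volume_Icc, sub_neg_eq_add, ← two_mul,
          ENNReal.ofReal_mul (by positivity : 0 ≤ 1 + ρ)]
        ring

end MeanSquareBounded

theorem closedBall_subset_setOf_lt_re {w : ℂ} {a ρ : ℝ} (h : a < w.re - ρ) :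
    closedBall w ρ ⊆ {s | a < s.re} := fun z hz => by
  rw [mem_closedBall, dist_comm, dist_eq_norm] at hz
  have hre := (le_abs_self _).trans ((Complex.abs_re_le_norm _).trans hz)
  rw [Complex.sub_re] at hre
  simp only [mem_ofPred_eq]
  linarith

theorem exists_forall_mem_closedBall {p α : ℝ} (hp : p < α) (β d : ℝ) :
    ∃ σ₀, d ≤ σ₀ ∧ p ≤ σ₀ ∧ ∀ σ ∈ Icc α β, ∀ y : ℝ, ∀ u ∈ Icc (0 : ℝ) 1,
      (σ + y * Complex.I + u * Complex.I : ℂ) ∈ closedBall (σ₀ + y * Complex.I) (σ₀ - p) := by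
  have hpα : 0 < α - p := sub_pos.2 hp
  set σ₀ := max (max d β) (α + 1 / (α - p))
  have hσ₀ : α + 1 / (α - p) ≤ σ₀ := le_max_right _ _
  have hβ : β ≤ σ₀ := (le_max_right _ _).trans (le_max_left _ _)
  have hinv : 0 < 1 / (α - p) := by positivity
  refine ⟨σ₀, (le_max_left _ _).trans (le_max_left _ _), by linarith, fun σ hσ y u hu => ?_⟩
  have hgap : 1 ≤ (α - p) * (σ₀ - α) :=
    ((mul_one_div_cancel hpα.ne').symm.le).trans (by gcongr; linarith)
  have hsub : (σ + y * Complex.I + u * Complex.I - (σ₀ + y * Complex.I) : ℂ) =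
      ((σ - σ₀ : ℝ) : ℂ) + u * Complex.I := by
    push_cast
    ring
  rw [mem_closedBall, dist_eq_norm, hsub, Complex.norm_add_mul_I, Real.sqrt_le_left (by linarith)]
  nlinarith [hσ.1, hσ.2, hu.1, hu.2]

theorem norm_le_sqrt_lintegral_square {f : ℂ → ℂ} (hm : Measurable f) {w z : ℂ} {R δ : ℝ}
    (hδ : 0 < δ) (hf : DifferentiableOn ℂ f (closedBall w (R + δ))) (hz : z ∈ closedBall w R)
    (hfin : ∫⁻ x in Icc (-(R + δ)) (R + δ), ∫⁻ u in Icc (-(R + δ)) (R + δ),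
      ‖f (w + (x + u * Complex.I))‖ₑ ^ 2 ≠ ∞) :
    ‖f z‖ ≤ √(1 + (∫⁻ x in Icc (-(R + δ)) (R + δ), ∫⁻ u in Icc (-(R + δ)) (R + δ),
      ‖f (w + (x + u * Complex.I))‖ₑ ^ 2).toReal / (π * δ ^ 2)) := by
  have hmean := pi_mul_sq_mul_enorm_le_lintegral_square (f := fun z => f z ^ 2) (by fun_prop) hδ.le
    (hf.pow 2) hz
  simp only [enorm_pow] at hmean
  have hreal := ENNReal.toReal_mono hfin hmean
  rw [ENNReal.toReal_mul, ENNReal.toReal_ofReal (by positivity), ENNReal.toReal_pow,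
    toReal_enorm, ← le_div_iff₀' (by positivity)] at hreal
  exact Real.le_sqrt_of_sq_le (by linarith)

theorem exists_setLIntegral_sq_log_norm_le_lintegral_square {r R δ c : ℝ} (hr : 0 ≤ r)
    (hrR : r < R) (hδ : 0 < δ) (hc : 0 < c) :
    ∃ D : ℝ≥0∞, D ≠ ∞ ∧ ∀ {G : ℂ → ℂ} {w : ℂ}, Measurable G →
      DifferentiableOn ℂ G (closedBall w (R + δ)) → c ≤ ‖G w‖ → ∀ x : ℂ,
      (∀ t ∈ Icc (0 : ℝ) 1, x + t * Complex.I ∈ closedBall w r) →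
      ∫⁻ t in Icc (0 : ℝ) 1, ‖Real.log ‖G (x + t * Complex.I)‖‖ₑ ^ 2 ≤
        D * (1 + ∫⁻ x in Icc (-(R + δ)) (R + δ), ∫⁻ u in Icc (-(R + δ)) (R + δ),
          ‖G (w + (x + u * Complex.I))‖ₑ ^ 2) := by
  obtain ⟨D, hD, hlog⟩ := exists_setLIntegral_sq_log_norm_le hr hrR hc
  set κ := π * δ ^ 2
  have hκ : 0 < κ := by positivity
  refine ⟨(D + 1) * (1 + (ENNReal.ofReal κ)⁻¹),
    by finiteness [ENNReal.inv_ne_top.2 (ENNReal.ofReal_pos.2 hκ).ne'],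
    fun {G w} hm hG hGw x hx => ?_⟩
  set I := ∫⁻ x in Icc (-(R + δ)) (R + δ), ∫⁻ u in Icc (-(R + δ)) (R + δ),
    ‖G (w + (x + u * Complex.I))‖ₑ ^ 2
  obtain hI_top | hfin := eq_or_ne I ∞
  · simp [hI_top]
  have hanalytic : AnalyticOnNhd ℂ G (closedBall w R) :=
    ((hG.mono ball_subset_closedBall).analyticOnNhd isOpen_ball).mono
      (closedBall_subset_ball (lt_add_of_pos_right R hδ))
  have hbound := hlog hanalytic (Real.one_le_sqrt.2 (le_add_of_nonneg_right (by positivity)))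
    (fun z hz => norm_le_sqrt_lintegral_square hm hδ hG hz hfin) hGw x hx
  rw [Real.sq_sqrt (by positivity), ENNReal.ofReal_add zero_le_one (by positivity),
    ENNReal.ofReal_div_of_pos hκ, ENNReal.ofReal_toReal hfin, ENNReal.ofReal_one,
    ENNReal.div_eq_inv_mul] at hbound
  calc _ ≤ D * (1 + (ENNReal.ofReal κ)⁻¹ * I) := hbound
    _ ≤ (D + 1) * ((1 + (ENNReal.ofReal κ)⁻¹) * (1 + I)) := by
        gcongr
        · exact le_self_add
        · rw [add_mul, one_mul, mul_add]
          exact add_le_add le_self_add le_add_self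
    _ = _ := (mul_assoc _ _ _).symm

theorem exists_setLIntegral_sq_log_norm_le_lintegral {a α c : ℝ} (hα : a < α) (hc : 0 < c)
    (β d : ℝ) :
    ∃ (D : ℝ≥0∞) (σ₀ ρ : ℝ), D ≠ ∞ ∧ 0 ≤ ρ ∧ a < σ₀ - ρ ∧ ∀ G : ℂ → ℂ, Measurable G →
      DifferentiableOn ℂ G {s | a < s.re} → (∀ s : ℂ, d ≤ s.re → c ≤ ‖G s‖) →
      ∀ y : ℝ, ∀ σ ∈ Icc α β,
        ∫⁻ u in Icc (0 : ℝ) 1, ‖Real.log ‖G (σ + ↑(y + u) * Complex.I)‖‖ₑ ^ 2 ≤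
          D * (1 + ∫⁻ x in Icc (-ρ) ρ, ∫⁻ u in Icc (-ρ) ρ,
            ‖G (↑(σ₀ + x) + ↑(y + u) * Complex.I)‖ₑ ^ 2) := by
  obtain ⟨δ, hδα⟩ : ∃ δ, α = a + 4 * δ := ⟨(α - a) / 4, by ring⟩
  have hδ : 0 < δ := by linarith
  obtain ⟨σ₀, hdσ₀, hσ₀, hline⟩ := exists_forall_mem_closedBall
    (by linarith : a + 3 * δ < α) β d
  obtain ⟨R, hR⟩ : ∃ R, R = σ₀ - (a + 2 * δ) := ⟨_, rfl⟩
  obtain ⟨D, hD, hlog⟩ := exists_setLIntegral_sq_log_norm_le_lintegral_square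
    (sub_nonneg.2 hσ₀) (by linarith : σ₀ - (a + 3 * δ) < R) hδ hc
  refine ⟨D, σ₀, R + δ, hD, by linarith, by linarith, fun G hm hG hlow y σ hσ => ?_⟩
  set w : ℂ := σ₀ + y * Complex.I
  have hsquare : ∀ x u : ℝ, (↑(σ₀ + x) + ↑(y + u) * Complex.I : ℂ) = w + (x + u * Complex.I) :=
    fun x u => by simp only [w]; push_cast; ring
  have hsegment : ∀ u : ℝ, (σ + ↑(y + u) * Complex.I : ℂ) = σ + y * Complex.I + u * Complex.I :=
    fun u => by push_cast; ring
  simp only [hsquare, hsegment]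
  exact hlog hm (hG.mono (closedBall_subset_setOf_lt_re (by simp [w]; linarith)))
    (hlow w (by simpa [w] using hdσ₀)) _ (hline σ hσ y)

theorem MeanSquareBounded.log_norm {G : ℂ → ℂ} {a c d : ℝ} (h : MeanSquareBounded G a)
    (hm : Measurable G) (hG : DifferentiableOn ℂ G {s | a < s.re}) (hc : 0 < c)
    (hlow : ∀ s : ℂ, d ≤ s.re → c ≤ ‖G s‖) :
    MeanSquareBounded (fun s => Real.log ‖G s‖) a := by
  intro α β hα
  obtain ⟨D, σ₀, ρ, hD, hρ, haρ, hlog⟩ :=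
    exists_setLIntegral_sq_log_norm_le_lintegral hα hc β d
  obtain ⟨C, hC, hrect⟩ := h.exists_lintegral_rectangle_le hm haρ hρ
  refine ⟨D * (4 + C * 2), by finiteness, fun T hT σ hσ => ?_⟩
  have : Measurable fun y : ℝ => ∫⁻ x in Icc (-ρ) ρ, ∫⁻ u in Icc (-ρ) ρ,
      ‖G (↑(σ₀ + x) + ↑(y + u) * Complex.I)‖ₑ ^ 2 := by
    fun_prop
  calc ∫⁻ t in Icc (-T) T, ‖Real.log ‖G (σ + t * Complex.I)‖‖ₑ ^ 2
      ≤ ∫⁻ y in Icc (-T - 1) T, ∫⁻ u in Icc (0 : ℝ) 1,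
          ‖Real.log ‖G (σ + ↑(y + u) * Complex.I)‖‖ₑ ^ 2 :=
        lintegral_Icc_le_lintegral_Icc_lintegral_add
          (F := fun t => ‖Real.log ‖G (σ + t * Complex.I)‖‖ₑ ^ 2) (by fun_prop) _ _
    _ ≤ ∫⁻ y in Icc (-(2 * T)) (2 * T), D * (1 + ∫⁻ x in Icc (-ρ) ρ, ∫⁻ u in Icc (-ρ) ρ,
          ‖G (↑(σ₀ + x) + ↑(y + u) * Complex.I)‖ₑ ^ 2) :=
        (lintegral_mono fun y => hlog G hm hG hlow y σ hσ).trans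
          (lintegral_mono_set (Icc_subset_Icc (by linarith) (by linarith)))
    _ ≤ D * (ENNReal.ofReal (4 * T) + C * ENNReal.ofReal (2 * T)) := by
        rw [lintegral_const_mul _ (by fun_prop), lintegral_add_left measurable_const,
          setLIntegral_const, Real.volume_Icc, one_mul]
        gcongr
        · linarith
        · exact hrect (2 * T) (by linarith)
    _ = D * (4 + C * 2) * ENNReal.ofReal T := by
        rw [ENNReal.ofReal_mul zero_le_four, ENNReal.ofReal_mul zero_le_two]
        simp only [ENNReal.ofReal_ofNat]
        ring

end MeanSquare

section Plancherel

open MeasureTheory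
open scoped FourierTransform ENNReal

variable {V E : Type*} [NormedAddCommGroup V] [InnerProductSpace ℝ V] [FiniteDimensional ℝ V]
  [MeasurableSpace V] [BorelSpace V] [NormedAddCommGroup E] [InnerProductSpace ℂ E]

theorem continuous_fourier_of_integrable {f : V → E} (hf : Integrable f) : Continuous (𝓕 f) :=
  VectorFourier.fourierIntegral_continuous Real.continuous_fourierChar
    (by exact continuous_inner) hf

variable [CompleteSpace E]

theorem integral_smul_fourier_toLp {f : V → E} (h₁ : Integrable f) (h₂ : MemLp f 2)
    (g : SchwartzMap V ℂ) :
    ∫ x, g x • (𝓕 (h₂.toLp f) : Lp E 2 (volume : Measure V)) x = ∫ x, g x • 𝓕 f x := by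
  have hdual := congrArg (fun T => T g) (Lp.fourier_toTemperedDistribution_eq (h₂.toLp f))
  simp only [TemperedDistribution.fourier_apply, Lp.toTemperedDistribution_apply] at hdual
  calc ∫ x, g x • (𝓕 (h₂.toLp f) : Lp E 2 (volume : Measure V)) x
      = ∫ x, 𝓕 g x • h₂.toLp f x := hdual.symm
    _ = ∫ x, 𝓕 g x • f x :=
        integral_congr_ae (h₂.coeFn_toLp.mono fun x hx => by simp only [hx])
    _ = ∫ x, g x • 𝓕 f x := by
        have hflip := VectorFourier.integral_fourierIntegral_smul_eq_flip (L := innerₗ V)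
          Real.continuous_fourierChar (by exact continuous_inner) g.integrable h₁
          (μ := volume) (ν := volume)
        rwa [flip_innerₗ] at hflip

theorem fourier_toLp_ae_eq {f : V → E} (h₁ : Integrable f) (h₂ : MemLp f 2) :
    (𝓕 (h₂.toLp f) : Lp E 2 (volume : Measure V)) =ᵐ[volume] 𝓕 f := by
  refine ae_eq_of_integral_contDiff_smul_eq ((Lp.memLp _).locallyIntegrable one_le_two)
    (continuous_fourier_of_integrable h₁).locallyIntegrable fun g hg hgc => ?_
  have hgc' : HasCompactSupport fun x => (g x : ℂ) := hgc.comp_left Complex.ofReal_zero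
  exact integral_smul_fourier_toLp h₁ h₂
    (hgc'.toSchwartzMap (Complex.ofRealCLM.contDiff.comp hg))

theorem eLpNorm_fourier_eq {f : V → E} (h₁ : Integrable f) (h₂ : MemLp f 2) :
    eLpNorm (𝓕 f) 2 volume = eLpNorm f 2 volume := by
  have hnorm := Lp.norm_fourier_eq (h₂.toLp f)
  rw [Lp.norm_def, Lp.norm_def, ENNReal.toReal_eq_toReal_iff' (Lp.eLpNorm_ne_top _)
    (Lp.eLpNorm_ne_top _)] at hnorm
  rw [← eLpNorm_congr_ae (fourier_toLp_ae_eq h₁ h₂), hnorm, eLpNorm_congr_ae h₂.coeFn_toLp]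

end Plancherel

section MellinPlancherel

open MeasureTheory Set Real
open scoped FourierTransform ENNReal

theorem image_exp_neg_univ : (fun u => rexp (-u)) '' univ = Ioi 0 := by
  rw [image_univ, ← Real.range_exp]
  exact neg_surjective.range_comp rexp

theorem hasDerivWithinAt_exp_neg (u : ℝ) (s : Set ℝ) :
    HasDerivWithinAt (fun u => rexp (-u)) (-rexp (-u)) s u := by
  simpa only [mul_neg_one] using ((hasDerivAt_neg u).exp).hasDerivWithinAt

theorem injective_exp_neg : Function.Injective fun u : ℝ => rexp (-u) :=
  Real.exp_injective.comp neg_injective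

theorem lintegral_comp_exp_neg (F : ℝ → ℝ≥0∞) :
    ∫⁻ u, F (rexp (-u)) = ∫⁻ x in Ioi 0, ENNReal.ofReal x⁻¹ * F x := by
  rw [← image_exp_neg_univ, lintegral_image_eq_lintegral_abs_deriv_mul MeasurableSet.univ
    (fun u _ => hasDerivWithinAt_exp_neg u univ) injective_exp_neg.injOn, Measure.restrict_univ]
  refine lintegral_congr fun u => ?_
  rw [abs_neg, abs_of_pos (exp_pos _), ← mul_assoc, ← ENNReal.ofReal_mul (exp_pos _).le,
    mul_inv_cancel₀ (exp_pos _).ne', ENNReal.ofReal_one, one_mul]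

variable {E : Type*} [NormedAddCommGroup E]

theorem integrable_exp_smul_of_mellinConvergent [NormedSpace ℂ E] {f : ℝ → E} {σ : ℝ}
    (hf : MellinConvergent f σ) : Integrable fun u : ℝ => rexp (-σ * u) • f (rexp (-u)) := by
  rw [MellinConvergent, ← image_exp_neg_univ, integrableOn_image_iff_integrableOn_abs_deriv_smul
    MeasurableSet.univ (fun u _ => hasDerivWithinAt_exp_neg u univ) injective_exp_neg.injOn,
    integrableOn_univ] at hf
  refine hf.congr (Eventually.of_forall fun u => ?_)
  have hcpow : (rexp (-u) : ℂ) ^ ((σ : ℂ) - 1) = (rexp (-u * (σ - 1)) : ℝ) := by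
    rw [Real.exp_mul, Complex.ofReal_cpow (exp_pos _).le]
    push_cast
    rfl
  dsimp only
  rw [hcpow, Complex.coe_smul, smul_smul, abs_neg, abs_of_pos (exp_pos _), ← Real.exp_add]
  ring_nf

theorem lintegral_comp_div (F : ℝ → ℝ≥0∞) {c : ℝ} (hc : 0 < c) :
    ∫⁻ t, F (t / c) = ENNReal.ofReal c * ∫⁻ x, F x := by
  have hmap := (measurableEmbedding_mulRight₀ (inv_ne_zero hc.ne')).lintegral_map F
    (μ := volume)
  rw [Real.map_volume_mul_right (inv_ne_zero hc.ne'), inv_inv, abs_of_pos hc,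
    lintegral_smul_measure, smul_eq_mul] at hmap
  simpa only [div_eq_mul_inv] using hmap.symm

theorem lintegral_mellin_sq_le [InnerProductSpace ℂ E] [CompleteSpace E] {f : ℝ → E} {σ : ℝ}
    (hf : MellinConvergent f σ) :
    ∫⁻ t : ℝ, ‖mellin f (σ + t * Complex.I)‖ₑ ^ 2 ≤
      ENNReal.ofReal (2 * π) *
        ∫⁻ x in Ioi 0, ENNReal.ofReal (x ^ (2 * σ - 1)) * ‖f x‖ₑ ^ 2 := by
  set g : ℝ → E := fun u => rexp (-σ * u) • f (rexp (-u))
  have hg : Integrable g := integrable_exp_smul_of_mellinConvergent hf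
  have hmellin (t : ℝ) : mellin f (σ + t * Complex.I) = 𝓕 g (t / (2 * π)) := by
    simp [mellin_eq_fourier, g]
  have hgsq : ∫⁻ u, ‖g u‖ₑ ^ 2 =
      ∫⁻ x in Ioi 0, ENNReal.ofReal (x ^ (2 * σ - 1)) * ‖f x‖ₑ ^ 2 := by
    calc ∫⁻ u, ‖g u‖ₑ ^ 2 = ∫⁻ u, ‖rexp (-u) ^ σ • f (rexp (-u))‖ₑ ^ 2 := by
          simp only [g, ← Real.exp_mul, neg_mul, mul_comm σ]
      _ = ∫⁻ x in Ioi 0, ENNReal.ofReal x⁻¹ * ‖x ^ σ • f x‖ₑ ^ 2 :=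
          lintegral_comp_exp_neg fun x => ‖x ^ σ • f x‖ₑ ^ 2
      _ = _ := setLIntegral_congr_fun measurableSet_Ioi fun x (hx : 0 < x) => by
          have hpow : x ^ (2 * σ - 1) = x⁻¹ * (x ^ σ) ^ 2 := by
            rw [Real.rpow_sub_one hx.ne', mul_comm 2 σ, Real.rpow_mul hx.le, Real.rpow_two]
            ring
          rw [hpow, enorm_smul, mul_pow, ← mul_assoc, Real.enorm_of_nonneg (by positivity),
            ← ENNReal.ofReal_pow (by positivity), ENNReal.ofReal_mul (by positivity)]
  simp only [hmellin]
  rw [lintegral_comp_div (fun ξ => ‖𝓕 g ξ‖ₑ ^ 2) two_pi_pos, ← hgsq, ← eLpNorm_two_sq,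
    ← eLpNorm_two_sq]
  gcongr
  by_cases hgfin : MemLp g 2
  · exact (eLpNorm_fourier_eq hg hgfin).le
  · have htop : eLpNorm g 2 volume = ∞ := by
      simpa only [MemLp, hg.aestronglyMeasurable, true_and, not_lt, top_le_iff] using hgfin
    exact htop ▸ le_top

end MellinPlancherel

section MellinMeanSquare

open MeasureTheory Set
open scoped ENNReal Real

theorem lintegral_rpow_mul_indicator_Ioc_le {c r y : ℝ} (hc : 1 ≤ c) (hr : 0 ≤ r) (hy : 0 < y) :
    ∫⁻ x in Ioi 0, ENNReal.ofReal (x ^ (-r - 1)) * (Ioc x (c * x)).indicator 1 y ≤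
      ENNReal.ofReal ((c - 1) * c ^ r) * ENNReal.ofReal (y ^ (-r)) := by
  have hc0 : 0 < c := one_pos.trans_le hc
  have hyc : 0 < y / c := by positivity
  calc ∫⁻ x in Ioi 0, ENNReal.ofReal (x ^ (-r - 1)) * (Ioc x (c * x)).indicator 1 y
      ≤ ∫⁻ x in Ioi 0, (Icc (y / c) y).indicator
          (fun _ => ENNReal.ofReal ((y / c) ^ (-r - 1))) x := by
        refine lintegral_mono fun x => ?_
        by_cases hxy : y ∈ Ioc x (c * x)
        · have hyx : y / c ≤ x := by rw [div_le_iff₀ hc0, mul_comm]; exact hxy.2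
          rw [indicator_of_mem hxy, indicator_of_mem (mem_Icc.2 ⟨hyx, hxy.1.le⟩), Pi.one_apply,
            mul_one]
          exact ENNReal.ofReal_le_ofReal
            (Real.rpow_le_rpow_of_nonpos hyc hyx (by linarith))
        · rw [indicator_of_notMem hxy, mul_zero]
          exact zero_le
    _ ≤ ENNReal.ofReal ((y / c) ^ (-r - 1)) * ENNReal.ofReal (y - y / c) := by
        refine (setLIntegral_le_lintegral _ _).trans (le_of_eq ?_)
        rw [lintegral_indicator_const measurableSet_Icc, Real.volume_Icc]
    _ = ENNReal.ofReal ((c - 1) * c ^ r) * ENNReal.ofReal (y ^ (-r)) := by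
        rw [← ENNReal.ofReal_mul (by positivity),
          ← ENNReal.ofReal_mul (mul_nonneg (by linarith) (by positivity)),
          Real.rpow_sub_one hyc.ne', Real.div_rpow hy.le hc0.le, Real.rpow_neg hc0.le r]
        congr 1
        field_simp

theorem lintegral_rpow_mul_measure_Ioc_le (ν : Measure ℝ) [SFinite ν] {c r : ℝ} (hc : 1 ≤ c)
    (hr : 0 ≤ r) : ∫⁻ x in Ioi 0, ENNReal.ofReal (x ^ (-r - 1)) * ν (Ioc x (c * x)) ≤
      ENNReal.ofReal ((c - 1) * c ^ r) * ∫⁻ y in Ioi 0, ENNReal.ofReal (y ^ (-r)) ∂ν := by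
  have hmeas : Measurable fun p : ℝ × ℝ =>
      ENNReal.ofReal (p.1 ^ (-r - 1)) * (Ioc p.1 (c * p.1)).indicator (1 : ℝ → ℝ≥0∞) p.2 := by
    have hset : MeasurableSet {p : ℝ × ℝ | p.1 < p.2 ∧ p.2 ≤ c * p.1} :=
      (measurableSet_lt measurable_fst measurable_snd).inter
        (measurableSet_le measurable_snd (measurable_fst.const_mul c))
    exact Measurable.mul (by fun_prop) (measurable_const.indicator hset)
  calc ∫⁻ x in Ioi 0, ENNReal.ofReal (x ^ (-r - 1)) * ν (Ioc x (c * x))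
      = ∫⁻ x in Ioi 0, ∫⁻ y in Ioi 0,
          ENNReal.ofReal (x ^ (-r - 1)) * (Ioc x (c * x)).indicator 1 y ∂ν :=
        setLIntegral_congr_fun measurableSet_Ioi fun x (hx : 0 < x) => by
          have hsub : Ioc x (c * x) ⊆ Ioi 0 := fun y hy => hx.trans hy.1
          rw [lintegral_const_mul' _ _ ENNReal.ofReal_ne_top, lintegral_indicator_one
            measurableSet_Ioc, Measure.restrict_apply measurableSet_Ioc, inter_eq_left.2 hsub]
    _ = ∫⁻ y in Ioi 0, (∫⁻ x in Ioi 0,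
          ENNReal.ofReal (x ^ (-r - 1)) * (Ioc x (c * x)).indicator 1 y) ∂ν :=
        lintegral_lintegral_swap hmeas.aemeasurable
    _ ≤ ∫⁻ y in Ioi 0, ENNReal.ofReal ((c - 1) * c ^ r) * ENNReal.ofReal (y ^ (-r)) ∂ν :=
        setLIntegral_mono' measurableSet_Ioi fun y hy =>
          lintegral_rpow_mul_indicator_Ioc_le hc hr hy
    _ = _ := lintegral_const_mul' _ _ ENNReal.ofReal_ne_top

theorem norm_div_two_le_norm_exp_sub_one {z : ℂ} (hz : ‖z‖ ≤ 1 / 2) :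
    ‖z‖ / 2 ≤ ‖Complex.exp z - 1‖ := by
  have htaylor := Complex.norm_exp_sub_one_sub_id_le (hz.trans (by norm_num))
  have htriangle := norm_sub_norm_le z (z - (Complex.exp z - 1))
  rw [sub_sub_cancel, norm_sub_rev z] at htriangle
  nlinarith [norm_nonneg z]

variable {E : Type*} [NormedAddCommGroup E]

theorem hasMellin_comp_exp_mul_sub [NormedSpace ℂ E] {S : ℝ → E} {s : ℂ}
    (hS : MellinConvergent S (-s)) (h : ℝ) :
    HasMellin (fun x => S (Real.exp h * x) - S x) (-s)
      ((Complex.exp (h * s) - 1) • mellin S (-s)) := by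
  have hshift := (MellinConvergent.comp_mul_left (Real.exp_pos h)).2 hS
  convert hasMellin_sub hshift hS using 1
  rw [mellin_comp_mul_left _ _ (Real.exp_pos h), neg_neg,
    Complex.cpow_def_of_ne_zero (Complex.ofReal_ne_zero.2 (Real.exp_pos h).ne'),
    ← Complex.ofReal_log (Real.exp_pos h).le, Real.log_exp, sub_smul, one_smul]

theorem enorm_smul_mellin_neg_le [NormedSpace ℂ E] {S : ℝ → E} {s : ℂ} {h : ℝ}
    (hS : MellinConvergent S (-s)) (hh : 0 < h) (hs : ‖(h : ℂ) * s‖ ≤ 1 / 2) :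
    ‖s • mellin S (-s)‖ₑ ≤
      ENNReal.ofReal (2 / h) * ‖mellin (fun x => S (Real.exp h * x) - S x) (-s)‖ₑ := by
  have hexp := norm_div_two_le_norm_exp_sub_one hs
  rw [norm_mul, Complex.norm_real, Real.norm_of_nonneg hh.le] at hexp
  rw [(hasMellin_comp_exp_mul_sub hS h).2, enorm_smul, enorm_smul, ← mul_assoc]
  gcongr
  rw [← ofReal_norm, ← ofReal_norm, ← ENNReal.ofReal_mul (by positivity)]
  refine ENNReal.ofReal_le_ofReal ?_
  rw [div_mul_eq_mul_div, le_div_iff₀ hh]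
  linarith

theorem lintegral_rpow_mul_enorm_sub_sq_le {S : ℝ → E} {B c r : ℝ} {ν : Measure ℝ} [SFinite ν]
    (hB : ∀ x, ‖S x‖ ≤ B) (hvar : ∀ x y, x ≤ y → ‖S y - S x‖ₑ ≤ ν (Ioc x y)) (hc : 1 ≤ c)
    (hr : 0 ≤ r) :
    ∫⁻ x in Ioi 0, ENNReal.ofReal (x ^ (-r - 1)) * ‖S (c * x) - S x‖ₑ ^ 2 ≤
      ENNReal.ofReal (2 * B) * (ENNReal.ofReal ((c - 1) * c ^ r) *
        ∫⁻ y in Ioi 0, ENNReal.ofReal (y ^ (-r)) ∂ν) := by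
  have hsq : ∀ x ∈ Ioi (0 : ℝ), ‖S (c * x) - S x‖ₑ ^ 2 ≤
      ENNReal.ofReal (2 * B) * ν (Ioc x (c * x)) := fun x hx => by
    rw [sq]
    refine mul_le_mul' ?_ (hvar _ _ (le_mul_of_one_le_left (mem_Ioi.1 hx).le hc))
    rw [← ofReal_norm, two_mul]
    exact ENNReal.ofReal_le_ofReal (norm_sub_le_of_le (hB _) (hB _))
  calc ∫⁻ x in Ioi 0, ENNReal.ofReal (x ^ (-r - 1)) * ‖S (c * x) - S x‖ₑ ^ 2
      ≤ ∫⁻ x in Ioi 0, ENNReal.ofReal (2 * B) *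
          (ENNReal.ofReal (x ^ (-r - 1)) * ν (Ioc x (c * x))) :=
        setLIntegral_mono' measurableSet_Ioi fun x hx => by
          rw [mul_left_comm]
          gcongr
          exact hsq x hx
    _ = ENNReal.ofReal (2 * B) *
          ∫⁻ x in Ioi 0, ENNReal.ofReal (x ^ (-r - 1)) * ν (Ioc x (c * x)) :=
        lintegral_const_mul' _ _ ENNReal.ofReal_ne_top
    _ ≤ _ := by
        gcongr
        exact lintegral_rpow_mul_measure_Ioc_le ν hc hr

variable [InnerProductSpace ℂ E] [CompleteSpace E]

theorem lintegral_smul_mellin_sq_le {S : ℝ → E} {σ T h : ℝ}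
    (hS : ∀ s : ℂ, s.re = σ → MellinConvergent S (-s)) (hh : 0 < h) (hT : h * (|σ| + T) ≤ 1 / 2) :
    ∫⁻ t in Icc (-T) T, ‖((σ : ℂ) + t * Complex.I) • mellin S (-(σ + t * Complex.I))‖ₑ ^ 2 ≤
      ENNReal.ofReal (2 / h) ^ 2 * (ENNReal.ofReal (2 * π) * ∫⁻ x in Ioi 0,
        ENNReal.ofReal (x ^ (-(2 * σ) - 1)) * ‖S (Real.exp h * x) - S x‖ₑ ^ 2) := by
  have hpointwise : ∀ t ∈ Icc (-T) T,
      ‖((σ : ℂ) + t * Complex.I) • mellin S (-(σ + t * Complex.I))‖ₑ ^ 2 ≤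
        ENNReal.ofReal (2 / h) ^ 2 *
          ‖mellin (fun x => S (Real.exp h * x) - S x) (-(σ + t * Complex.I))‖ₑ ^ 2 := by
    intro t ht
    set s : ℂ := σ + t * Complex.I
    have hs : ‖(h : ℂ) * s‖ ≤ 1 / 2 := by
      refine le_trans ?_ hT
      rw [norm_mul, Complex.norm_real, Real.norm_of_nonneg hh.le]
      gcongr
      calc ‖s‖ ≤ |s.re| + |s.im| := Complex.norm_le_abs_re_add_abs_im s
        _ = |σ| + |t| := by simp [s]
        _ ≤ |σ| + T := by gcongr; exact abs_le.2 ht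
    rw [← mul_pow]
    gcongr
    exact enorm_smul_mellin_neg_le (hS s (by simp [s])) hh hs
  have hdiff : MellinConvergent (fun x => S (Real.exp h * x) - S x) ((-σ : ℝ) : ℂ) := by
    rw [Complex.ofReal_neg]
    exact (hasMellin_comp_exp_mul_sub (hS σ (Complex.ofReal_re σ)) h).1
  calc ∫⁻ t in Icc (-T) T, ‖((σ : ℂ) + t * Complex.I) • mellin S (-(σ + t * Complex.I))‖ₑ ^ 2
      ≤ ∫⁻ t : ℝ, ENNReal.ofReal (2 / h) ^ 2 *
          ‖mellin (fun x => S (Real.exp h * x) - S x) (-(σ + t * Complex.I))‖ₑ ^ 2 :=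
        (setLIntegral_mono' measurableSet_Icc hpointwise).trans (setLIntegral_le_lintegral _ _)
    _ = ENNReal.ofReal (2 / h) ^ 2 *
          ∫⁻ t : ℝ, ‖mellin (fun x => S (Real.exp h * x) - S x)
            ((-σ : ℝ) + (t : ℝ) * Complex.I)‖ₑ ^ 2 := by
        rw [lintegral_const_mul' _ _ (by finiteness), ← (Measure.measurePreserving_neg
          volume).lintegral_comp_emb (MeasurableEquiv.neg ℝ).measurableEmbedding]
        refine congrArg _ (lintegral_congr fun t => ?_)
        push_cast
        ring_nf
    _ ≤ _ := by
        gcongr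
        refine (lintegral_mellin_sq_le hdiff).trans_eq ?_
        ring_nf

theorem rpow_neg_le_add {y p q r : ℝ} (hy : 0 < y) (hpr : p ≤ r) (hrq : r ≤ q) :
    y ^ (-r) ≤ y ^ (-p) + y ^ (-q) := by
  rcases le_total 1 y with h1 | h1
  · exact (Real.rpow_le_rpow_of_exponent_le h1 (by linarith)).trans
      (le_add_of_nonneg_right (by positivity))
  · exact (Real.rpow_le_rpow_of_exponent_ge hy h1 (by linarith)).trans
      (le_add_of_nonneg_left (by positivity))

theorem exp_sub_one_mul_exp_rpow_le {h r : ℝ} (h0 : 0 ≤ h) (h1 : h ≤ 1) (hr : h * r ≤ 1) :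
    (Real.exp h - 1) * Real.exp h ^ r ≤ 6 * h := by
  have hlin : Real.exp h - 1 ≤ 2 * h := by
    have := Real.abs_exp_sub_one_le (x := h) (by rwa [abs_of_nonneg h0])
    rw [abs_of_nonneg h0] at this
    exact (le_abs_self _).trans this
  have hexp : Real.exp h ^ r ≤ 3 := by
    rw [← Real.exp_mul]
    exact (Real.exp_le_exp.2 hr).trans (by linarith [Real.exp_one_lt_d9])
  nlinarith [Real.exp_pos h, Real.add_one_le_exp h, Real.rpow_pos_of_pos (Real.exp_pos h) r]

theorem lintegral_rpow_neg_le_add (ν : Measure ℝ) {p q r : ℝ} (hr : r ∈ Icc p q) :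
    ∫⁻ y in Ioi 0, ENNReal.ofReal (y ^ (-r)) ∂ν ≤
      ∫⁻ y in Ioi 0, ENNReal.ofReal (y ^ (-p)) ∂ν +
        ∫⁻ y in Ioi 0, ENNReal.ofReal (y ^ (-q)) ∂ν := by
  rw [← lintegral_add_left (by fun_prop)]
  refine setLIntegral_mono' measurableSet_Ioi fun y (hy : 0 < y) => ?_
  rw [← ENNReal.ofReal_add (by positivity) (by positivity)]
  exact ENNReal.ofReal_le_ofReal (rpow_neg_le_add hy hr.1 hr.2)

theorem lintegral_smul_mellin_sq_le_div {S : ℝ → E} {B σ T h : ℝ} {ν : Measure ℝ} [SFinite ν]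
    (hS : ∀ s : ℂ, s.re = σ → MellinConvergent S (-s)) (hB : ∀ x, ‖S x‖ ≤ B)
    (hvar : ∀ x y, x ≤ y → ‖S y - S x‖ₑ ≤ ν (Ioc x y)) (hσ : 0 ≤ σ) (hT : 1 ≤ T)
    (hh : 0 < h) (hhT : h * (σ + T) ≤ 1 / 2) :
    ∫⁻ t in Icc (-T) T, ‖((σ : ℂ) + t * Complex.I) • mellin S (-(σ + t * Complex.I))‖ₑ ^ 2 ≤
      ENNReal.ofReal (96 * π * B / h) * ∫⁻ y in Ioi 0, ENNReal.ofReal (y ^ (-(2 * σ))) ∂ν := by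
  have hB0 : 0 ≤ B := (norm_nonneg _).trans (hB 0)
  have hexp : (Real.exp h - 1) * Real.exp h ^ (2 * σ) ≤ 6 * h :=
    exp_sub_one_mul_exp_rpow_le hh.le (by nlinarith) (by nlinarith)
  calc ∫⁻ t in Icc (-T) T, ‖((σ : ℂ) + t * Complex.I) • mellin S (-(σ + t * Complex.I))‖ₑ ^ 2
      ≤ ENNReal.ofReal (2 / h) ^ 2 * (ENNReal.ofReal (2 * π) * ∫⁻ x in Ioi 0,
          ENNReal.ofReal (x ^ (-(2 * σ) - 1)) * ‖S (Real.exp h * x) - S x‖ₑ ^ 2) :=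
        lintegral_smul_mellin_sq_le hS hh (by rwa [abs_of_nonneg hσ])
    _ ≤ ENNReal.ofReal (2 / h) ^ 2 * (ENNReal.ofReal (2 * π) * (ENNReal.ofReal (2 * B) *
          (ENNReal.ofReal (6 * h) * ∫⁻ y in Ioi 0, ENNReal.ofReal (y ^ (-(2 * σ))) ∂ν))) := by
        gcongr
        refine (lintegral_rpow_mul_enorm_sub_sq_le hB hvar (Real.one_le_exp hh.le)
          (by positivity)).trans ?_
        gcongr
    _ = _ := by
        rw [← mul_assoc (ENNReal.ofReal (2 * B)), ← mul_assoc (ENNReal.ofReal (2 * π)),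
          ← mul_assoc (ENNReal.ofReal (2 / h) ^ 2), ← ENNReal.ofReal_mul (by positivity),
          ← ENNReal.ofReal_mul (by positivity), ← ENNReal.ofReal_pow (by positivity),
          ← ENNReal.ofReal_mul (by positivity)]
        congr 2
        field_simp
        ring

theorem meanSquareBounded_smul_mellin_neg {S : ℝ → E} {κ B : ℝ} {ν : Measure ℝ} [SFinite ν]
    (hκ : 0 ≤ κ) (hS : ∀ s : ℂ, κ < s.re → MellinConvergent S (-s)) (hB : ∀ x, ‖S x‖ ≤ B)
    (hvar : ∀ x y, x ≤ y → ‖S y - S x‖ₑ ≤ ν (Ioc x y))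
    (hν : ∀ σ, κ < σ → ∫⁻ y in Ioi 0, ENNReal.ofReal (y ^ (-(2 * σ))) ∂ν ≠ ∞) :
    MeanSquareBounded (fun s => s • mellin S (-s)) κ := by
  intro α β hα
  rcases lt_or_ge β α with hβα | hαβ
  · exact ⟨0, ENNReal.zero_ne_top, fun T _ σ hσ => absurd (hσ.1.trans hσ.2) hβα.not_ge⟩
  set I : ℝ → ℝ≥0∞ := fun σ => ∫⁻ y in Ioi 0, ENNReal.ofReal (y ^ (-(2 * σ))) ∂ν
  refine ⟨ENNReal.ofReal (192 * π * B * (β + 1)) * (I α + I β), ENNReal.mul_ne_top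
    ENNReal.ofReal_ne_top (ENNReal.add_ne_top.2 ⟨hν α hα, hν β (hα.trans_le hαβ)⟩),
    fun T hT σ hσ => ?_⟩
  have hB0 : 0 ≤ B := (norm_nonneg _).trans (hB 0)
  have hσ0 : 0 < σ := by linarith [hσ.1]
  have hβ0 : 0 < β := hσ0.trans_le hσ.2
  have hI : I σ ≤ I α + I β :=
    lintegral_rpow_neg_le_add ν ⟨by linarith [hσ.1], by linarith [hσ.2]⟩
  calc ∫⁻ t in Icc (-T) T, ‖((σ : ℂ) + t * Complex.I) • mellin S (-(σ + t * Complex.I))‖ₑ ^ 2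
      ≤ ENNReal.ofReal (96 * π * B / (1 / (2 * (β + T)))) * I σ := by
        refine lintegral_smul_mellin_sq_le_div (fun s hs => hS s (by linarith [hσ.1])) hB hvar
          hσ0.le hT (by positivity) ?_
        rw [one_div_mul_eq_div, div_le_div_iff₀ (by positivity) two_pos]
        linarith [hσ.2]
    _ ≤ ENNReal.ofReal (192 * π * B * (β + 1) * T) * (I α + I β) := by
        rw [show 96 * π * B / (1 / (2 * (β + T))) = 192 * π * B * (β + T) by field_simp; ring,
          mul_assoc _ (β + 1)]
        gcongr
        nlinarith
    _ = _ := by rw [ENNReal.ofReal_mul (by positivity), mul_right_comm]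

end MellinMeanSquare

section ShiftedDirichletSeries

open MeasureTheory Set

/-- The summatory function `∑_{n + α ≤ x} a n` of the coefficients of the shifted Dirichlet series
`∑ a n / (n + α) ^ s`. -/
noncomputable def shiftedSummatory (a : ℕ → ℂ) (α x : ℝ) : ℂ :=
  ∑ n ∈ Finset.range ⌊x + 1 - α⌋₊, a n

variable {a : ℕ → ℂ} {α x : ℝ}

theorem lt_floor_add_one_sub_iff {n : ℕ} : n < ⌊x + 1 - α⌋₊ ↔ n + α ≤ x := by
  rw [← Nat.add_one_le_iff, Nat.le_floor_iff' (Nat.succ_ne_zero n)]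
  push_cast
  constructor <;> intro h <;> linarith

theorem floor_add_one_sub_eq_zero (h : x < α) : ⌊x + 1 - α⌋₊ = 0 :=
  Nat.floor_eq_zero.2 (by linarith)

theorem measurable_shiftedSummatory (a : ℕ → ℂ) (α : ℝ) : Measurable (shiftedSummatory a α) :=
  (measurable_from_nat (f := fun N => ∑ n ∈ Finset.range N, a n)).comp
    (Nat.measurable_floor.comp (by fun_prop))

theorem enorm_shiftedSummatory_sub_le (ha : ∀ n, ‖a n‖ ≤ 1) (α : ℝ) {x y : ℝ} (hxy : x ≤ y) :
    ‖shiftedSummatory a α y - shiftedSummatory a α x‖ₑ ≤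
      Measure.sum (fun n : ℕ => Measure.dirac (n + α)) (Ioc x y) := by
  rw [shiftedSummatory, shiftedSummatory,
    ← Finset.sum_Ico_eq_sub _ (Nat.floor_mono (by linarith)), Measure.sum_apply _ measurableSet_Ioc]
  refine (enorm_sum_le _ _).trans (le_trans (Finset.sum_le_sum fun n hn => ?_)
    (ENNReal.sum_le_tsum (Finset.Ico ⌊x + 1 - α⌋₊ ⌊y + 1 - α⌋₊)))
  rw [Finset.mem_Ico, lt_floor_add_one_sub_iff, ← not_lt, lt_floor_add_one_sub_iff, not_le] at hn
  rw [Measure.dirac_apply' _ measurableSet_Ioc, indicator_of_mem (mem_Ioc.2 hn), Pi.one_apply,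
    ← ofReal_norm]
  exact ENNReal.ofReal_le_one.2 (ha n)

theorem norm_sum_range_min_floor_le {C κ : ℝ} (hα : 0 < α) (hκ : 0 ≤ κ)
    (ha : ∀ N : ℕ, ‖∑ n ∈ Finset.range N, a n‖ ≤ C * N ^ κ) (N : ℕ) (hx : α ≤ x) :
    ‖∑ n ∈ Finset.range (min N ⌊x + 1 - α⌋₊), a n‖ ≤ C * (1 + 1 / α) ^ κ * x ^ κ := by
  have hx0 : 0 < x := hα.trans_le hx
  have hC : 0 ≤ C := by simpa using (norm_nonneg _).trans (ha 1)
  have hmin : (min N ⌊x + 1 - α⌋₊ : ℕ) ≤ (1 + 1 / α) * x := by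
    calc ((min N ⌊x + 1 - α⌋₊ : ℕ) : ℝ) ≤ (⌊x + 1 - α⌋₊ : ℝ) := by
          exact_mod_cast min_le_right _ _
      _ ≤ x + 1 - α := Nat.floor_le (by linarith)
      _ ≤ x + x / α := by linarith [(one_le_div hα).2 hx]
      _ = (1 + 1 / α) * x := by ring
  calc _ ≤ C * (min N ⌊x + 1 - α⌋₊ : ℕ) ^ κ := ha _
    _ ≤ C * ((1 + 1 / α) * x) ^ κ := by gcongr
    _ = _ := by rw [Real.mul_rpow (by positivity) hx0.le, mul_assoc]

theorem integrableOn_indicator_Ici {E : Type*} [NormedAddCommGroup E] {f : ℝ → E} {c : ℝ}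
    (hf : IntegrableOn f (Ioi c)) (s : Set ℝ) : IntegrableOn ((Ici c).indicator f) s :=
  ((integrable_indicator_iff measurableSet_Ici).2
    ((integrableOn_Ici_iff_integrableOn_Ioi).2 hf)).integrableOn

theorem hasMellin_indicator_Ici {c : ℝ} (hc : 0 < c) {s : ℂ} (hs : 0 < s.re) :
    HasMellin ((Ici c).indicator (1 : ℝ → ℂ)) (-s) ((c : ℂ) ^ (-s) / s) := by
  have hre : (-s - 1).re < -1 := by simpa using by linarith
  have hsmul : (fun t : ℝ => (t : ℂ) ^ (-s - 1) • (Ici c).indicator (1 : ℝ → ℂ) t) =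
      (Ici c).indicator (fun t : ℝ => (t : ℂ) ^ (-s - 1)) := by
    funext t
    by_cases ht : t ∈ Ici c <;> simp [ht]
  constructor
  · rw [MellinConvergent, hsmul]
    exact integrableOn_indicator_Ici (integrableOn_Ioi_cpow_of_lt hre hc) _
  · rw [mellin, hsmul, setIntegral_indicator measurableSet_Ici,
      inter_eq_right.2 (Ici_subset_Ioi.2 hc), integral_Ici_eq_integral_Ioi,
      integral_Ioi_cpow_of_lt hre hc, sub_add_cancel, neg_div_neg_eq]

theorem sum_mul_indicator_Ici (a : ℕ → ℂ) (α : ℝ) (N : ℕ) (x : ℝ) :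
    ∑ n ∈ Finset.range N, a n * (Ici ((n : ℝ) + α)).indicator 1 x =
      ∑ n ∈ Finset.range (min N ⌊x + 1 - α⌋₊), a n := by
  have hfilter : Finset.range (min N ⌊x + 1 - α⌋₊) =
      (Finset.range N).filter fun n : ℕ => x ∈ Ici ((n : ℝ) + α) := by
    ext n
    simp only [Finset.mem_range, lt_min_iff, Finset.mem_filter, mem_Ici, lt_floor_add_one_sub_iff]
  rw [hfilter, Finset.sum_filter]
  refine Finset.sum_congr rfl fun n _ => ?_
  by_cases hx : x ∈ Ici ((n : ℝ) + α) <;> simp [hx]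

theorem sum_div_cpow_eq_mul_mellin (a : ℕ → ℂ) (hα : 0 < α) {s : ℂ} (hs : 0 < s.re) (N : ℕ) :
    ∑ n ∈ Finset.range N, a n / ((n : ℂ) + α) ^ s =
      s * mellin (fun x => ∑ n ∈ Finset.range (min N ⌊x + 1 - α⌋₊), a n) (-s) := by
  have hs0 : s ≠ 0 := by rintro rfl; simp at hs
  have hstep (n : ℕ) := hasMellin_indicator_Ici (c := n + α) (by positivity) hs
  simp only [← sum_mul_indicator_Ici, mellin, Finset.smul_sum, ← mul_smul_comm]
  rw [integral_finsetSum _ fun n _ => (hstep n).1.integrable.const_mul _, Finset.mul_sum]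
  refine Finset.sum_congr rfl fun n _ => ?_
  have hvalue := (hstep n).2
  rw [mellin] at hvalue
  rw [integral_const_mul, hvalue, Complex.cpow_neg]
  push_cast
  field_simp

theorem norm_cpow_smul_sum_le {C κ : ℝ} {s : ℂ}
    (hC : ∀ (N : ℕ) (x : ℝ), α ≤ x →
      ‖∑ n ∈ Finset.range (min N ⌊x + 1 - α⌋₊), a n‖ ≤ C * x ^ κ) (N : ℕ) (hx : 0 < x) :
    ‖(x : ℂ) ^ (-s - 1) • ∑ n ∈ Finset.range (min N ⌊x + 1 - α⌋₊), a n‖ ≤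
      (Ici α).indicator (fun x => C * x ^ (κ - s.re - 1)) x := by
  rcases le_or_gt α x with hαx | hαx
  · rw [indicator_of_mem (mem_Ici.2 hαx), norm_smul, Complex.norm_cpow_eq_rpow_re_of_pos hx]
    calc _ ≤ x ^ (-s - 1).re * (C * x ^ κ) := by gcongr; exact hC N x hαx
      _ = C * x ^ ((-s - 1).re + κ) := by rw [Real.rpow_add hx]; ring
      _ = _ := by simp only [Complex.sub_re, Complex.neg_re, Complex.one_re]; ring_nf
  · rw [floor_add_one_sub_eq_zero hαx, min_zero, Finset.sum_range_zero, smul_zero, norm_zero,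
      indicator_of_notMem (notMem_Ici.2 hαx)]

theorem mellinConvergent_shiftedSummatory {C κ : ℝ} {s : ℂ} (hα : 0 < α) (hκ : 0 ≤ κ)
    (hs : κ < s.re) (ha : ∀ N : ℕ, ‖∑ n ∈ Finset.range N, a n‖ ≤ C * N ^ κ) :
    MellinConvergent (shiftedSummatory a α) (-s) := by
  refine Integrable.mono' (integrableOn_indicator_Ici ((integrableOn_Ioi_rpow_of_lt
    (by linarith : κ - s.re - 1 < -1) hα).const_mul (C * (1 + 1 / α) ^ κ)) _)
    ((by fun_prop : Measurable fun t : ℝ => (t : ℂ) ^ (-s - 1)).smul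
      (measurable_shiftedSummatory a α)).aestronglyMeasurable ?_
  filter_upwards [ae_restrict_mem measurableSet_Ioi] with x hx
  simpa only [min_self, shiftedSummatory] using norm_cpow_smul_sum_le
    (fun N _ => norm_sum_range_min_floor_le hα hκ ha N) ⌊x + 1 - α⌋₊ hx

theorem tendsto_sum_div_cpow {C κ : ℝ} {s : ℂ} (hα : 0 < α) (hκ : 0 ≤ κ)
    (hs : κ < s.re) (ha : ∀ N : ℕ, ‖∑ n ∈ Finset.range N, a n‖ ≤ C * N ^ κ) :
    Tendsto (fun N => ∑ n ∈ Finset.range N, a n / ((n : ℂ) + α) ^ s) atTop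
      (𝓝 (s * mellin (shiftedSummatory a α) (-s))) := by
  have hmeas (N : ℕ) : Measurable fun x : ℝ =>
      ∑ n ∈ Finset.range (min N ⌊x + 1 - α⌋₊), a n :=
    (measurable_from_nat (f := fun M => ∑ n ∈ Finset.range (min N M), a n)).comp
      (Nat.measurable_floor.comp (by fun_prop))
  simp only [sum_div_cpow_eq_mul_mellin a hα (hκ.trans_lt hs)]
  refine Tendsto.const_mul s (tendsto_integral_of_dominated_convergence _ (fun N =>
      ((by fun_prop : Measurable fun t : ℝ => (t : ℂ) ^ (-s - 1)).smul
        (hmeas N)).aestronglyMeasurable)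
    (integrableOn_indicator_Ici ((integrableOn_Ioi_rpow_of_lt
      (by linarith : κ - s.re - 1 < -1) hα).const_mul (C * (1 + 1 / α) ^ κ)) _)
    (fun N => (ae_restrict_mem measurableSet_Ioi).mono fun x hx => norm_cpow_smul_sum_le
      (fun N _ => norm_sum_range_min_floor_le hα hκ ha N) N hx)
    (Eventually.of_forall fun x => tendsto_const_nhds.congr' ?_))
  filter_upwards [eventually_ge_atTop ⌊x + 1 - α⌋₊] with N hN
  rw [min_eq_right hN, shiftedSummatory]

end ShiftedDirichletSeries

section SummatoryRemainder

open MeasureTheory Set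

section Mellin

variable {E : Type*} [NormedAddCommGroup E] {f : ℝ → E} {B c : ℝ} {s : ℂ}

theorem isBigO_nhdsGT_zero_of_forall_lt_eq_zero (hc : 0 < c) (h0 : ∀ x < c, f x = 0) (g : ℝ → ℝ) :
    f =O[𝓝[>] 0] g :=
  Asymptotics.IsBigO.of_bound 0 (nhdsWithin_le_nhds
    (mem_of_superset (Iio_mem_nhds hc) fun x hx => by simp [h0 x hx]))

theorem isBigO_atTop_rpow_neg_zero_of_norm_le (hB : ∀ x, ‖f x‖ ≤ B) :
    f =O[atTop] fun x : ℝ => x ^ (-(0 : ℝ)) :=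
  Asymptotics.IsBigO.of_bound B (Eventually.of_forall fun x => by simpa using hB x)

theorem locallyIntegrableOn_of_norm_le (hf : AEStronglyMeasurable f) (hB : ∀ x, ‖f x‖ ≤ B)
    (A : Set ℝ) : LocallyIntegrableOn f A :=
  ((locallyIntegrable_const B).mono hf (Eventually.of_forall fun x =>
    (hB x).trans (le_abs_self B))).locallyIntegrableOn A

variable [NormedSpace ℂ E]

theorem mellinConvergent_of_norm_le (hf : AEStronglyMeasurable f) (hB : ∀ x, ‖f x‖ ≤ B)
    (hc : 0 < c) (h0 : ∀ x < c, f x = 0) (hs : s.re < 0) : MellinConvergent f s :=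
  mellinConvergent_of_isBigO_rpow (locallyIntegrableOn_of_norm_le hf hB _)
    (isBigO_atTop_rpow_neg_zero_of_norm_le hB) hs
    (isBigO_nhdsGT_zero_of_forall_lt_eq_zero hc h0 _) (sub_one_lt s.re)

theorem differentiableAt_mellin_of_norm_le (hf : AEStronglyMeasurable f) (hB : ∀ x, ‖f x‖ ≤ B)
    (hc : 0 < c) (h0 : ∀ x < c, f x = 0) (hs : s.re < 0) : DifferentiableAt ℂ (mellin f) s :=
  mellin_differentiableAt_of_isBigO_rpow (locallyIntegrableOn_of_norm_le hf hB _)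
    (isBigO_atTop_rpow_neg_zero_of_norm_le hB) hs
    (isBigO_nhdsGT_zero_of_forall_lt_eq_zero hc h0 _) (sub_one_lt s.re)

theorem measurable_mellin {f : ℝ → ℂ} (hf : Measurable f) : Measurable (mellin f) :=
  (StronglyMeasurable.integral_prod_right (f := fun (s : ℂ) (t : ℝ) => (t : ℂ) ^ (s - 1) • f t)
    (Measurable.stronglyMeasurable (by fun_prop))).measurable

end Mellin

theorem hasMellin_max_sub_one {s : ℂ} (hs : 1 < s.re) :
    HasMellin (fun x : ℝ => ((max (x - 1) 0 : ℝ) : ℂ)) (-s) (1 / (s - 1) - 1 / s) := by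
  have hs0 : s ≠ 0 := by rintro rfl; norm_num at hs
  have hs1 : s - 1 ≠ 0 := sub_ne_zero.2 (by rintro rfl; norm_num at hs)
  have hre : (-s).re < -1 := by simpa using hs
  have hre' : (-s - 1).re < -1 := by simp; linarith
  have hint := integrableOn_Ioi_cpow_of_lt hre one_pos
  have hint' := integrableOn_Ioi_cpow_of_lt hre' one_pos
  have hpiece : EqOn (fun t : ℝ => (t : ℂ) ^ (-s - 1) • ((max (t - 1) 0 : ℝ) : ℂ))
      ((Ici 1).indicator fun t : ℝ => (t : ℂ) ^ (-s) - (t : ℂ) ^ (-s - 1)) (Ioi 0) := by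
    intro t ht
    have ht0 : (t : ℂ) ≠ 0 := Complex.ofReal_ne_zero.2 (ne_of_gt ht)
    rcases le_or_gt 1 t with h | h
    · simp only [indicator_of_mem (mem_Ici.2 h), smul_eq_mul]
      rw [max_eq_left (sub_nonneg.2 h), Complex.cpow_sub _ _ ht0, Complex.cpow_one]
      push_cast
      field_simp
    · simp [indicator_of_notMem (notMem_Ici.2 h), max_eq_right (sub_nonpos.2 h.le)]
  constructor
  · rw [MellinConvergent, integrableOn_congr_fun hpiece measurableSet_Ioi]
    exact integrableOn_indicator_Ici (hint.sub hint') _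
  · rw [mellin, setIntegral_congr_fun measurableSet_Ioi hpiece,
      setIntegral_indicator measurableSet_Ici, inter_eq_right.2 (Ici_subset_Ioi.2 one_pos),
      integral_Ici_eq_integral_Ioi, integral_sub hint hint', integral_Ioi_cpow_of_lt hre one_pos,
      integral_Ioi_cpow_of_lt hre' one_pos]
    simp only [Complex.ofReal_one, Complex.one_cpow]
    rw [show -s + 1 = -(s - 1) by ring, sub_add_cancel]
    field_simp

/-- The summatory function of `a`, corrected by the main term `E (x - 1)⁺` which accounts for a
pole of `∑ a n / (n + α) ^ s` at `s = 1` with residue `E`. -/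
noncomputable def summatoryRemainder (a : ℕ → ℂ) (α : ℝ) (E : ℂ) (x : ℝ) : ℂ :=
  shiftedSummatory a α x - E * (max (x - 1) 0 : ℝ)

/-- The function `(s - 1) / (s + 1) * ∑ a n / (n + α) ^ s`, continued across its removable
singularity at `s = 1`; here `E` is the residue of the series there. -/
noncomputable def regularizedSeries (a : ℕ → ℂ) (α : ℝ) (E s : ℂ) : ℂ :=
  ((s - 1) * (s * mellin (summatoryRemainder a α E) (-s)) + E) / (s + 1)

variable {a : ℕ → ℂ} {α B : ℝ} {E s : ℂ}

theorem summatoryRemainder_of_lt (hα : α ≤ 1) {x : ℝ} (hx : x < α) :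
    summatoryRemainder a α E x = 0 := by
  rw [summatoryRemainder, shiftedSummatory, floor_add_one_sub_eq_zero hx,
    max_eq_right (by linarith)]
  simp

theorem measurable_summatoryRemainder (a : ℕ → ℂ) (α : ℝ) (E : ℂ) :
    Measurable (summatoryRemainder a α E) :=
  (measurable_shiftedSummatory a α).sub (by fun_prop)

theorem tendsto_sum_div_cpow_of_one_lt_re (hα : 0 < α) (ha : ∀ n, ‖a n‖ ≤ 1) (E : ℂ)
    (hs : 1 < s.re) :
    Tendsto (fun N => ∑ n ∈ Finset.range N, a n / ((n : ℂ) + α) ^ s) atTop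
      (𝓝 (s * mellin (summatoryRemainder a α E) (-s) + E / (s - 1))) := by
  have hs0 : s ≠ 0 := by rintro rfl; norm_num at hs
  have hs1 : s - 1 ≠ 0 := sub_ne_zero.2 (by rintro rfl; norm_num at hs)
  have hsum (N : ℕ) : ‖∑ n ∈ Finset.range N, a n‖ ≤ 1 * (N : ℝ) ^ (1 : ℝ) := by
    simpa using norm_sum_le_of_le (Finset.range N) fun n _ => ha n
  have hmain := hasMellin_max_sub_one hs
  have hrem := (hasMellin_sub (mellinConvergent_shiftedSummatory hα zero_le_one hs hsum)
    (hmain.1.const_smul E)).2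
  rw [mellin_const_smul, hmain.2, smul_eq_mul] at hrem
  convert tendsto_sum_div_cpow hα zero_le_one hs hsum using 2
  change s * mellin (fun x => shiftedSummatory a α x - E • ((max (x - 1) 0 : ℝ) : ℂ)) (-s) + _ = _
  rw [hrem]
  field_simp
  ring

theorem measurable_regularizedSeries (a : ℕ → ℂ) (α : ℝ) (E : ℂ) :
    Measurable (regularizedSeries a α E) := by
  have hmellin := measurable_mellin (measurable_summatoryRemainder a α E)
  unfold regularizedSeries
  fun_prop

theorem add_one_ne_zero_of_re_pos (hs : 0 < s.re) : s + 1 ≠ 0 := fun h => by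
  have hre := congrArg Complex.re h
  simp only [Complex.add_re, Complex.one_re, Complex.zero_re] at hre
  linarith

theorem differentiableOn_regularizedSeries (hα : 0 < α) (hα' : α ≤ 1)
    (hB : ∀ x, ‖summatoryRemainder a α E x‖ ≤ B) :
    DifferentiableOn ℂ (regularizedSeries a α E) {s | 0 < s.re} := by
  intro s hs
  have hmellin : DifferentiableAt ℂ (fun z => mellin (summatoryRemainder a α E) (-z)) s :=
    (differentiableAt_mellin_of_norm_le (measurable_summatoryRemainder a α E).aestronglyMeasurable
      hB hα (fun x hx => summatoryRemainder_of_lt hα' hx) (by simpa using hs)).comp s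
      differentiableAt_id.neg
  have hden := add_one_ne_zero_of_re_pos hs
  refine DifferentiableAt.differentiableWithinAt ?_
  unfold regularizedSeries
  fun_prop (disch := assumption)

theorem ofReal_max_sub_max_le_volume {x y : ℝ} :
    ENNReal.ofReal (max (y - 1) 0 - max (x - 1) 0) ≤ volume.restrict (Ioi (1 : ℝ)) (Ioc x y) := by
  rw [Measure.restrict_apply measurableSet_Ioc, Ioc_inter_Ioi, Real.volume_Ioc]
  rcases le_total y 1 with hy | hy
  · rw [max_eq_right (sub_nonpos.2 hy), zero_sub, ENNReal.ofReal_of_nonpos (by simp)]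
    exact zero_le
  · refine ENNReal.ofReal_le_ofReal ?_
    rw [max_eq_left (sub_nonneg.2 hy), ← sub_self (1 : ℝ), max_sub_sub_right,
      sub_sub_sub_cancel_right]

/-- A majorant for the variation of `summatoryRemainder a α E` when the `a n` and `E` lie in the
unit disc. -/
noncomputable def summatoryVariation (α : ℝ) : Measure ℝ :=
  Measure.sum (fun n : ℕ => Measure.dirac (n + α)) + volume.restrict (Ioi 1)

instance summatoryVariation.instSFinite (α : ℝ) : SFinite (summatoryVariation α) := by
  unfold summatoryVariation
  infer_instance

theorem enorm_summatoryRemainder_sub_le (ha : ∀ n, ‖a n‖ ≤ 1) (hE : ‖E‖ ≤ 1) {x y : ℝ}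
    (hxy : x ≤ y) : ‖summatoryRemainder a α E y - summatoryRemainder a α E x‖ₑ ≤
      summatoryVariation α (Ioc x y) := by
  have hmono : max (x - 1) 0 ≤ max (y - 1) 0 := by gcongr
  calc ‖summatoryRemainder a α E y - summatoryRemainder a α E x‖ₑ
      = ‖shiftedSummatory a α y - shiftedSummatory a α x -
          E * (max (y - 1) 0 - max (x - 1) 0 : ℝ)‖ₑ := by
        simp only [summatoryRemainder]
        push_cast
        ring_nf
    _ ≤ ‖shiftedSummatory a α y - shiftedSummatory a α x‖ₑ +
          ‖E * (max (y - 1) 0 - max (x - 1) 0 : ℝ)‖ₑ := enorm_sub_le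
    _ ≤ summatoryVariation α (Ioc x y) := by
        rw [summatoryVariation, Measure.add_apply]
        gcongr
        · exact enorm_shiftedSummatory_sub_le ha α hxy
        · refine le_trans ?_ ofReal_max_sub_max_le_volume
          rw [← ofReal_norm, norm_mul, Complex.norm_of_nonneg (sub_nonneg.2 hmono)]
          exact ENNReal.ofReal_le_ofReal (mul_le_of_le_one_left (sub_nonneg.2 hmono) hE)

theorem lintegral_rpow_neg_summatoryVariation_ne_top (hα : 0 < α) {r : ℝ} (hr : 1 < r) :
    ∫⁻ y in Ioi 0, ENNReal.ofReal (y ^ (-r)) ∂summatoryVariation α ≠ ⊤ := by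
  refine ne_top_of_le_ne_top ?_ (setLIntegral_le_lintegral _ _)
  rw [summatoryVariation, lintegral_add_measure, lintegral_sum_measure]
  refine ENNReal.add_ne_top.2 ⟨?_, ?_⟩
  · simp only [lintegral_dirac]
    refine Summable.tsum_ofReal_ne_top
      (((Real.summable_one_div_nat_add_rpow α r).2 hr).congr fun n => ?_)
    rw [abs_of_pos (by positivity), Real.rpow_neg (by positivity), one_div]
  · exact (integrableOn_Ioi_rpow_of_lt (neg_lt_neg hr) one_pos).lintegral_lt_top.ne

theorem meanSquareBounded_mul_mellin_summatoryRemainder (hα : 0 < α) (hα' : α ≤ 1)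
    (ha : ∀ n, ‖a n‖ ≤ 1) (hE : ‖E‖ ≤ 1) (hB : ∀ x, ‖summatoryRemainder a α E x‖ ≤ B) :
    MeanSquareBounded (fun s => s * mellin (summatoryRemainder a α E) (-s)) (1 / 2) :=
  meanSquareBounded_smul_mellin_neg (by norm_num)
    (fun s hs => mellinConvergent_of_norm_le
      (measurable_summatoryRemainder a α E).aestronglyMeasurable hB hα
      (fun x hx => summatoryRemainder_of_lt hα' hx) (by rw [Complex.neg_re]; linarith))
    hB (fun x y hxy => enorm_summatoryRemainder_sub_le ha hE hxy)
    (fun σ hσ => lintegral_rpow_neg_summatoryVariation_ne_top hα (by linarith))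

end SummatoryRemainder

section MeanSquareTransfer

open MeasureTheory Set

theorem meanSquareBounded_const {E : Type*} [NormedAddCommGroup E] (c : E) (a : ℝ) :
    MeanSquareBounded (fun _ => c) a := fun _ _ _ => by
  refine ⟨‖c‖ₑ ^ 2 * 2, by finiteness, fun T _ _ _ => le_of_eq ?_⟩
  rw [setLIntegral_const, Real.volume_Icc, sub_neg_eq_add, ← two_mul,
    ENNReal.ofReal_mul zero_le_two, ENNReal.ofReal_ofNat, mul_assoc]

theorem meanSquareBounded_log_one_add_div_abs_im {c : ℝ} (hc : 0 ≤ c) (a : ℝ) :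
    MeanSquareBounded (fun s => Real.log (1 + c / |s.im|)) a := fun _ _ _ => by
  obtain ⟨K, hK, hle⟩ := exists_setLIntegral_sq_log_one_add_div_le hc
  refine ⟨K * 3, by finiteness, fun T hT σ _ => ?_⟩
  have him (t : ℝ) : (σ + t * Complex.I : ℂ).im = t - 0 := by simp
  simp only [him]
  refine (hle 0 _).trans ?_
  rw [mul_assoc, Real.volume_Icc, ← ENNReal.ofReal_one, ← ENNReal.ofReal_ofNat 3,
    ← ENNReal.ofReal_add zero_le_one (by linarith), ← ENNReal.ofReal_mul zero_le_three]
  gcongr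
  linarith

namespace MeanSquareBounded

variable {E F G : Type*} [NormedAddCommGroup E] [NormedAddCommGroup F] [NormedAddCommGroup G]

theorem of_norm_le_add {f : ℂ → E} {g : ℂ → F} {h : ℂ → G} {a : ℝ} (hf : MeanSquareBounded f a)
    (hg : MeanSquareBounded g a) (hfm : Measurable fun s => ‖f s‖ₑ)
    (hle : ∀ s : ℂ, a < s.re → s.im ≠ 0 → ‖h s‖ ≤ ‖f s‖ + ‖g s‖) : MeanSquareBounded h a := by
  intro α β hα
  obtain ⟨C, hC, hfC⟩ := hf α β hα
  obtain ⟨D, hD, hgD⟩ := hg α β hα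
  refine ⟨2 * (C + D), by finiteness, fun T hT σ hσ => ?_⟩
  have hpt (t : ℝ) (ht : t ≠ 0) : ‖h (σ + t * Complex.I)‖ₑ ^ 2 ≤
      2 * (‖f (σ + t * Complex.I)‖ₑ ^ 2 + ‖g (σ + t * Complex.I)‖ₑ ^ 2) := by
    have hnorm := hle (σ + t * Complex.I) (by simpa using hα.trans_le hσ.1) (by simpa using ht)
    simp only [← ofReal_norm]
    rw [← ENNReal.ofReal_pow (norm_nonneg _), ← ENNReal.ofReal_pow (norm_nonneg _),
      ← ENNReal.ofReal_pow (norm_nonneg _), ← ENNReal.ofReal_add (by positivity) (by positivity),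
      ← ENNReal.ofReal_ofNat, ← ENNReal.ofReal_mul zero_le_two]
    exact ENNReal.ofReal_le_ofReal
      ((pow_le_pow_left₀ (norm_nonneg _) hnorm 2).trans add_sq_le)
  calc ∫⁻ t in Icc (-T) T, ‖h (σ + t * Complex.I)‖ₑ ^ 2
      ≤ ∫⁻ t in Icc (-T) T,
          2 * (‖f (σ + t * Complex.I)‖ₑ ^ 2 + ‖g (σ + t * Complex.I)‖ₑ ^ 2) :=
        lintegral_mono_ae (ae_restrict_of_ae ((Measure.ae_ne volume 0).mono hpt))
    _ = 2 * ((∫⁻ t in Icc (-T) T, ‖f (σ + t * Complex.I)‖ₑ ^ 2) +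
          ∫⁻ t in Icc (-T) T, ‖g (σ + t * Complex.I)‖ₑ ^ 2) := by
        rw [lintegral_const_mul' _ _ (by norm_num), lintegral_add_left]
        exact (hfm.comp (by fun_prop : Measurable fun t : ℝ => σ + t * Complex.I)).pow_const 2
    _ ≤ 2 * (C * ENNReal.ofReal T + D * ENNReal.ofReal T) := by
        gcongr
        · exact hfC T hT σ hσ
        · exact hgD T hT σ hσ
    _ = _ := by ring

theorem exists_integral_sq_le {f : ℂ → ℝ} {a α β : ℝ} (h : MeanSquareBounded f a) (hα : a < α)
    (hf : ∀ σ : ℝ, α ≤ σ → AEStronglyMeasurable fun t : ℝ => f (σ + t * Complex.I)) :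
    ∃ C : ℝ, 0 < C ∧ ∀ T : ℝ, 1 ≤ T → ∀ σ : ℝ, α ≤ σ → σ ≤ β →
      IntervalIntegrable (fun t : ℝ => f (σ + t * Complex.I) ^ 2) volume 0 T ∧
      ∫ t in (0 : ℝ)..T, f (σ + t * Complex.I) ^ 2 ≤ C * T := by
  obtain ⟨C, hC, hle⟩ := h α β hα
  refine ⟨C.toReal + 1, by positivity, fun T hT σ hασ hσβ => ?_⟩
  have hT0 : 0 ≤ T := zero_le_one.trans hT
  have hbound : ∫⁻ t in Ioc 0 T, ‖f (σ + t * Complex.I) ^ 2‖ₑ ≤ C * ENNReal.ofReal T := by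
    simp only [enorm_pow]
    exact (lintegral_mono_set (Ioc_subset_Icc_self.trans
      (Icc_subset_Icc_left (neg_nonpos.2 hT0)))).trans (hle T hT σ ⟨hασ, hσβ⟩)
  have hint : IntegrableOn (fun t : ℝ => f (σ + t * Complex.I) ^ 2) (Ioc 0 T) :=
    ⟨((hf σ hασ).pow 2).restrict, hbound.trans_lt (by finiteness)⟩
  refine ⟨(intervalIntegrable_iff_integrableOn_Ioc_of_le hT0).2 hint, ?_⟩
  rw [intervalIntegral.integral_of_le hT0, integral_eq_lintegral_of_nonneg_ae
    (Eventually.of_forall fun t => sq_nonneg _) hint.1]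
  simp only [← Real.enorm_of_nonneg (sq_nonneg _)]
  calc _ ≤ (C * ENNReal.ofReal T).toReal := ENNReal.toReal_mono (by finiteness) hbound
    _ = C.toReal * T := by rw [ENNReal.toReal_mul, ENNReal.toReal_ofReal hT0]
    _ ≤ (C.toReal + 1) * T := by gcongr; linarith

end MeanSquareBounded

end MeanSquareTransfer

section RegularizedSeries

variable {a : ℕ → ℂ} {α B : ℝ} {E s : ℂ}

theorem norm_sub_one_le_norm_add_one (hs : 0 ≤ s.re) : ‖s - 1‖ ≤ ‖s + 1‖ := by
  refine le_of_sq_le_sq ?_ (norm_nonneg _)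
  rw [Complex.sq_norm, Complex.sq_norm, Complex.normSq_apply, Complex.normSq_apply]
  simp only [Complex.sub_re, Complex.add_re, Complex.sub_im, Complex.add_im, Complex.one_re,
    Complex.one_im]
  nlinarith

theorem norm_add_one_le_norm_sub_one_add_two (s : ℂ) : ‖s + 1‖ ≤ ‖s - 1‖ + 2 := by
  calc ‖s + 1‖ = ‖(s - 1) + 2‖ := by ring_nf
    _ ≤ ‖s - 1‖ + 2 := (norm_add_le _ _).trans_eq (by rw [Complex.norm_ofNat])

theorem norm_regularizedSeries_le (hE : ‖E‖ ≤ 1) (hs : 0 < s.re) :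
    ‖regularizedSeries a α E s‖ ≤ ‖(1 : ℝ)‖ + ‖s * mellin (summatoryRemainder a α E) (-s)‖ := by
  have hden : 1 ≤ ‖s + 1‖ := le_trans (by simpa using hs.le) (Complex.re_le_norm _)
  rw [regularizedSeries, norm_div, div_le_iff₀ (one_pos.trans_le hden), norm_one]
  refine (norm_add_le _ _).trans ?_
  rw [norm_mul (s - 1)]
  nlinarith [norm_nonneg (s * mellin (summatoryRemainder a α E) (-s)),
    mul_le_mul_of_nonneg_right (norm_sub_one_le_norm_add_one hs.le)
      (norm_nonneg (s * mellin (summatoryRemainder a α E) (-s)))]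

theorem meanSquareBounded_regularizedSeries (hα : 0 < α) (hα' : α ≤ 1) (ha : ∀ n, ‖a n‖ ≤ 1)
    (hE : ‖E‖ ≤ 1) (hB : ∀ x, ‖summatoryRemainder a α E x‖ ≤ B) :
    MeanSquareBounded (regularizedSeries a α E) (1 / 2) :=
  (meanSquareBounded_const (1 : ℝ) _).of_norm_le_add
    (meanSquareBounded_mul_mellin_summatoryRemainder hα hα' ha hE hB) measurable_const
    fun _ hs _ => norm_regularizedSeries_le hE (by linarith)

theorem sum_one_div_add_two_sq_le (N : ℕ) :
    ∑ n ∈ Finset.range N, 1 / ((n : ℝ) + 2) ^ 2 ≤ Real.pi ^ 2 / 6 - 1 := by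
  have hzeta := sum_le_hasSum (Finset.range (N + 2)) (fun n _ => by positivity) hasSum_zeta_two
  rw [Finset.sum_range_succ', Finset.sum_range_succ'] at hzeta
  norm_num [add_assoc] at hzeta ⊢
  linarith

theorem norm_cpow_mul_div_cpow_le {c : ℂ} (hc : ‖c‖ ≤ 1) (hα : 0 < α) (hα' : α ≤ 1)
    (hs : 2 ≤ s.re) (n : ℕ) :
    ‖(α : ℂ) ^ s * (c / ((n : ℂ) + α) ^ s)‖ ≤ 1 / ((n : ℝ) + 1) ^ 2 := by
  have hn : 0 < (n : ℝ) + α := by positivity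
  have hratio : α / (n + α) ≤ 1 / ((n : ℝ) + 1) := by
    rw [div_le_div_iff₀ hn (by positivity)]
    nlinarith [n.cast_nonneg (α := ℝ)]
  have hle_one : 1 / ((n : ℝ) + 1) ≤ 1 := by
    rw [div_le_one (by positivity)]
    linarith [n.cast_nonneg (α := ℝ)]
  calc ‖(α : ℂ) ^ s * (c / ((n : ℂ) + α) ^ s)‖ = ‖c‖ * (α / (n + α)) ^ s.re := by
        rw [Real.div_rpow hα.le hn.le, norm_mul, norm_div, ← Complex.norm_cpow_eq_rpow_re_of_pos hα,
          ← Complex.norm_cpow_eq_rpow_re_of_pos hn]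
        push_cast
        ring
    _ ≤ 1 * (1 / ((n : ℝ) + 1)) ^ (2 : ℝ) := by
        gcongr ?_ * ?_
        exact (Real.rpow_le_rpow_of_exponent_ge (by positivity) (hratio.trans hle_one) hs).trans
          (by gcongr)
    _ = 1 / ((n : ℝ) + 1) ^ 2 := by rw [one_mul, Real.rpow_two, div_pow, one_pow]

theorem norm_cpow_mul_sum_sub_one_le (ha : ∀ n, ‖a n‖ ≤ 1) (ha0 : a 0 = 1) (hα : 0 < α)
    (hα' : α ≤ 1) (hs : 2 ≤ s.re) (N : ℕ) :
    ‖(α : ℂ) ^ s * (∑ n ∈ Finset.range (N + 1), a n / ((n : ℂ) + α) ^ s) - 1‖ ≤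
      Real.pi ^ 2 / 6 - 1 := by
  have hfirst : (α : ℂ) ^ s * (a 0 / ((0 : ℕ) + α) ^ s) = 1 := by
    rw [ha0, Nat.cast_zero, zero_add, one_div, mul_inv_cancel₀]
    exact Complex.cpow_ne_zero_iff.2 (Or.inl (Complex.ofReal_ne_zero.2 hα.ne'))
  rw [Finset.sum_range_succ', mul_add, hfirst, add_sub_cancel_right, Finset.mul_sum]
  refine (norm_sum_le_of_le _ fun n _ => ?_).trans (sum_one_div_add_two_sq_le N)
  refine (norm_cpow_mul_div_cpow_le (ha (n + 1)) hα hα' hs (n + 1)).trans (le_of_eq ?_)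
  push_cast
  ring

theorem two_sub_le_norm_of_tendsto {z : ℂ} (ha : ∀ n, ‖a n‖ ≤ 1) (ha0 : a 0 = 1) (hα : 0 < α)
    (hα' : α ≤ 1) (hs : 2 ≤ s.re)
    (hz : Tendsto (fun N => ∑ n ∈ Finset.range N, a n / ((n : ℂ) + α) ^ s) atTop (𝓝 z)) :
    2 - Real.pi ^ 2 / 6 ≤ ‖z‖ := by
  have hdist : ‖(α : ℂ) ^ s * z - 1‖ ≤ Real.pi ^ 2 / 6 - 1 :=
    le_of_tendsto (((((tendsto_add_atTop_iff_nat 1).2 hz).const_mul _).sub_const 1).norm)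
      (Eventually.of_forall fun N => norm_cpow_mul_sum_sub_one_le ha ha0 hα hα' hs N)
  have hscale : ‖(α : ℂ) ^ s * z‖ ≤ ‖z‖ := by
    rw [norm_mul, Complex.norm_cpow_eq_rpow_re_of_pos hα]
    exact mul_le_of_le_one_left (norm_nonneg z)
      (Real.rpow_le_one hα.le hα' (by linarith))
  have htriangle := norm_sub_norm_le 1 (1 - (α : ℂ) ^ s * z)
  rw [norm_one, sub_sub_cancel, norm_sub_rev] at htriangle
  linarith

end RegularizedSeries

section Lerch

open MeasureTheory Set

/-- The coefficients `e^{2πiλn}` of the Lerch series. -/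
noncomputable def lerchCoeff (lam : ℝ) (n : ℕ) : ℂ :=
  Complex.exp (2 * Real.pi * Complex.I * lam * n)

open Classical in
/-- The residue of `L(λ, α, s)` at `s = 1`. -/
noncomputable def lerchResidue (lam : ℝ) : ℂ :=
  if ∃ k : ℤ, (k : ℝ) = lam then 1 else 0

/-- The function `(s - 1) / (s + 1) * L(λ, α, s)` in the half-plane `Re s > 0`, with the possible
pole at `s = 1` removed. -/
noncomputable def regularizedLerch (lam α : ℝ) : ℂ → ℂ :=
  regularizedSeries (lerchCoeff lam) α (lerchResidue lam)

variable {lam α : ℝ} {s : ℂ}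

theorem norm_lerchCoeff (lam : ℝ) (n : ℕ) : ‖lerchCoeff lam n‖ = 1 := by
  simp [lerchCoeff, Complex.norm_exp]

theorem lerchCoeff_intCast (k : ℤ) (n : ℕ) : lerchCoeff k n = 1 := by
  rw [lerchCoeff, Complex.exp_eq_one_iff]
  exact ⟨k * n, by push_cast; ring⟩

theorem lerchResidue_intCast (k : ℤ) : lerchResidue k = 1 :=
  if_pos ⟨k, rfl⟩

theorem lerchResidue_of_not_int (h : ¬ ∃ k : ℤ, (k : ℝ) = lam) : lerchResidue lam = 0 :=
  if_neg h

theorem norm_lerchResidue_le_one (lam : ℝ) : ‖lerchResidue lam‖ ≤ 1 := by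
  unfold lerchResidue
  split_ifs <;> simp

theorem norm_summatoryRemainder_intCast_le (k : ℤ) (hα : 0 < α) (hα' : α ≤ 1) (x : ℝ) :
    ‖summatoryRemainder (lerchCoeff k) α 1 x‖ ≤ 2 := by
  rcases lt_or_ge x α with hx | hx
  · simp [summatoryRemainder_of_lt hα' hx]
  have hcount : summatoryRemainder (lerchCoeff k) α 1 x =
      ((⌊x + 1 - α⌋₊ - max (x - 1) 0 : ℝ) : ℂ) := by
    simp [summatoryRemainder, shiftedSummatory, lerchCoeff_intCast]
  rw [hcount, Complex.norm_real, Real.norm_eq_abs, abs_le]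
  have hfloor := Nat.floor_le (by linarith : 0 ≤ x + 1 - α)
  have hfloor' := Nat.lt_floor_add_one (x + 1 - α)
  have hmax := le_max_left (x - 1) 0
  have hmax' : max (x - 1) 0 ≤ x := max_le (by linarith) (by linarith)
  constructor <;> linarith

theorem exists_norm_summatoryRemainder_lerchCoeff_le (lam : ℝ) (hα : 0 < α) (hα' : α ≤ 1) :
    ∃ B, ∀ x, ‖summatoryRemainder (lerchCoeff lam) α (lerchResidue lam) x‖ ≤ B := by
  by_cases h : ∃ k : ℤ, (k : ℝ) = lam
  · obtain ⟨k, rfl⟩ := h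
    rw [lerchResidue_intCast]
    exact ⟨2, norm_summatoryRemainder_intCast_le k hα hα'⟩
  · obtain ⟨B, hB⟩ := lerch_exp_sum_bounded lam h
    refine ⟨B, fun x => ?_⟩
    rw [lerchResidue_of_not_int h, summatoryRemainder, zero_mul, sub_zero]
    exact hB _

theorem tendsto_sum_lerchCoeff_div_cpow (lam : ℝ) (hα : 0 < α) (hα' : α ≤ 1) (hs : 1 < s.re) :
    Tendsto (fun N => ∑ n ∈ Finset.range N, lerchCoeff lam n / ((n : ℂ) + α) ^ s) atTop
      (𝓝 (lerchZeta lam α s)) := by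
  by_cases h : ∃ k : ℤ, (k : ℝ) = lam
  · obtain ⟨k, rfl⟩ := h
    simp only [lerchCoeff_intCast]
    exact (hasSum_lerchZeta_of_int k α hα hα' s hs).tendsto_sum_nat
  · exact tendsto_lerchPartialSum lam α h hα s (by linarith)

theorem lerchZeta_mul_sub_one_of_one_lt_re (lam : ℝ) (hα : 0 < α) (hα' : α ≤ 1)
    (hs : 1 < s.re) : lerchZeta lam α s * (s - 1) = regularizedLerch lam α s * (s + 1) := by
  have hs1 : s - 1 ≠ 0 := sub_ne_zero.2 (by rintro rfl; norm_num at hs)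
  rw [tendsto_nhds_unique (tendsto_sum_lerchCoeff_div_cpow lam hα hα' hs)
    (tendsto_sum_div_cpow_of_one_lt_re hα (fun n => (norm_lerchCoeff lam n).le)
      (lerchResidue lam) hs), regularizedLerch, regularizedSeries,
    div_mul_cancel₀ _ (add_one_ne_zero_of_re_pos (by linarith))]
  field_simp

theorem differentiable_update_sub_one_mul_hurwitzZeta (a : UnitAddCircle) :
    Differentiable ℂ (Function.update (fun s => (s - 1) * HurwitzZeta.hurwitzZeta a s) 1 1) := by
  rw [← differentiableOn_univ,
    ← Complex.differentiableOn_compl_singleton_and_continuousAt_iff (univ_mem : univ ∈ 𝓝 (1 : ℂ))]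
  refine ⟨fun s hs => ?_, continuousAt_update_same.2 (HurwitzZeta.hurwitzZeta_residue_one a)⟩
  have hs1 : s ≠ 1 := hs.2
  refine DifferentiableAt.differentiableWithinAt (DifferentiableAt.congr_of_eventuallyEq
    ((by fun_prop : DifferentiableAt ℂ (fun s : ℂ => s - 1) s).mul
      (HurwitzZeta.differentiableAt_hurwitzZeta a hs1)) ?_)
  filter_upwards [isOpen_ne.mem_nhds hs1] with z hz
  exact Function.update_of_ne hz _ _

theorem differentiableOn_regularizedLerch (lam : ℝ) (hα : 0 < α) (hα' : α ≤ 1) :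
    DifferentiableOn ℂ (regularizedLerch lam α) {s | 0 < s.re} :=
  (exists_norm_summatoryRemainder_lerchCoeff_le lam hα hα').elim fun _ hB =>
    differentiableOn_regularizedSeries hα hα' hB

theorem lerchZeta_intCast_mul_sub_one (k : ℤ) (hα : 0 < α) (hα' : α ≤ 1) (hs : 0 < s.re)
    (hs1 : s ≠ 1) : lerchZeta k α s * (s - 1) = regularizedLerch k α s * (s + 1) := by
  have hzeta (z : ℂ) : lerchZeta k α z = HurwitzZeta.hurwitzZeta (α : UnitAddCircle) z :=
    if_pos ⟨k, rfl⟩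
  have hopen : IsOpen {z : ℂ | 0 < z.re} := isOpen_lt continuous_const Complex.continuous_re
  have hnear : {z : ℂ | 1 < z.re} ∈ 𝓝 (2 : ℂ) :=
    (isOpen_lt continuous_const Complex.continuous_re).mem_nhds (by simp)
  have hidentity := AnalyticOnNhd.eqOn_of_preconnected_of_eventuallyEq
    (g := fun z => regularizedLerch k α z * (z + 1))
    ((differentiable_update_sub_one_mul_hurwitzZeta α).differentiableOn.analyticOnNhd hopen)
    (((differentiableOn_regularizedLerch k hα hα').mul (by fun_prop)).analyticOnNhd hopen)
    (convex_halfSpace_re_gt 0).isPreconnected (z₀ := 2) (by simp) ?_ hs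
  · rw [Function.update_of_ne hs1] at hidentity
    rw [hzeta, mul_comm, hidentity]
  · filter_upwards [hnear] with z hz
    have hz1 : z ≠ 1 := by rintro rfl; exact absurd hz (by simp)
    rw [Function.update_of_ne hz1, ← hzeta, mul_comm]
    exact lerchZeta_mul_sub_one_of_one_lt_re k hα hα' hz

theorem lerchZeta_mul_sub_one (lam : ℝ) (hα : 0 < α) (hα' : α ≤ 1) (hs : 0 < s.re)
    (hs1 : s ≠ 1) : lerchZeta lam α s * (s - 1) = regularizedLerch lam α s * (s + 1) := by
  by_cases h : ∃ k : ℤ, (k : ℝ) = lam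
  · obtain ⟨k, rfl⟩ := h
    exact lerchZeta_intCast_mul_sub_one k hα hα' hs hs1
  · obtain ⟨B, hB⟩ := lerch_exp_sum_bounded lam h
    have hmellin := tendsto_nhds_unique (tendsto_lerchPartialSum lam α h hα s hs)
      (tendsto_sum_div_cpow (a := lerchCoeff lam) hα le_rfl hs
        (fun N => by rw [Real.rpow_zero, mul_one]; exact hB N))
    rw [regularizedLerch, regularizedSeries, div_mul_cancel₀ _ (add_one_ne_zero_of_re_pos hs),
      hmellin, lerchResidue_of_not_int h, add_zero, mul_comm]
    simp only [funext fun x => show summatoryRemainder (lerchCoeff lam) α 0 x = _ by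
      rw [summatoryRemainder, zero_mul, sub_zero]]

theorem two_sub_div_three_le_norm_regularizedLerch (lam : ℝ) (hα : 0 < α) (hα' : α ≤ 1)
    (hs : 2 ≤ s.re) : (2 - Real.pi ^ 2 / 6) / 3 ≤ ‖regularizedLerch lam α s‖ := by
  have hlower : 2 - Real.pi ^ 2 / 6 ≤ ‖lerchZeta lam α s‖ :=
    two_sub_le_norm_of_tendsto (fun n => (norm_lerchCoeff lam n).le) (by simp [lerchCoeff]) hα hα'
      hs (tendsto_sum_lerchCoeff_div_cpow lam hα hα' (by linarith))
  have hnorm : ‖lerchZeta lam α s‖ * ‖s - 1‖ = ‖regularizedLerch lam α s‖ * ‖s + 1‖ := by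
    rw [← norm_mul, ← norm_mul, lerchZeta_mul_sub_one_of_one_lt_re lam hα hα' (by linarith)]
  have hsub : 1 ≤ ‖s - 1‖ := le_trans (by simp; linarith) (Complex.re_le_norm (s - 1))
  have hadd := norm_add_one_le_norm_sub_one_add_two s
  rw [div_le_iff₀ three_pos]
  refine le_of_mul_le_mul_right ?_ (one_pos.trans_le hsub)
  calc (2 - Real.pi ^ 2 / 6) * ‖s - 1‖ ≤ ‖lerchZeta lam α s‖ * ‖s - 1‖ := by gcongr
    _ = ‖regularizedLerch lam α s‖ * ‖s + 1‖ := hnorm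
    _ ≤ ‖regularizedLerch lam α s‖ * (3 * ‖s - 1‖) := by gcongr; linarith
    _ = _ := by ring

theorem abs_log_norm_le_of_mul_sub_one_eq {z w : ℂ} (hs : 0 ≤ s.re) (him : s.im ≠ 0)
    (h : z * (s - 1) = w * (s + 1)) :
    |Real.log ‖z‖| ≤ |Real.log ‖w‖| + Real.log (1 + 2 / |s.im|) := by
  have him0 : 0 < |s.im| := abs_pos.2 him
  have him_le : |s.im| ≤ ‖s - 1‖ := by simpa using Complex.abs_im_le_norm (s - 1)
  have hsub : 0 < ‖s - 1‖ := him0.trans_le him_le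
  have hquot_ge : 1 ≤ ‖s + 1‖ / ‖s - 1‖ := (one_le_div hsub).2 (norm_sub_one_le_norm_add_one hs)
  have hquot_le : ‖s + 1‖ / ‖s - 1‖ ≤ 1 + 2 / |s.im| :=
    calc ‖s + 1‖ / ‖s - 1‖ ≤ (‖s - 1‖ + 2) / ‖s - 1‖ := by
          gcongr
          exact norm_add_one_le_norm_sub_one_add_two s
      _ = 1 + 2 / ‖s - 1‖ := by field_simp
      _ ≤ 1 + 2 / |s.im| := by gcongr
  have hlog : |Real.log (‖s + 1‖ / ‖s - 1‖)| ≤ Real.log (1 + 2 / |s.im|) := by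
    rw [abs_of_nonneg (Real.log_nonneg hquot_ge)]
    gcongr
  have hz : ‖z‖ = ‖w‖ * (‖s + 1‖ / ‖s - 1‖) := by
    rw [← mul_div_assoc, ← norm_mul, ← h, norm_mul, mul_div_cancel_right₀ _ hsub.ne']
  rcases eq_or_ne ‖w‖ 0 with hw | hw
  · rw [hz, hw, zero_mul, Real.log_zero, abs_zero, zero_add]
    exact (abs_nonneg _).trans hlog
  · rw [hz, Real.log_mul hw (one_pos.trans_le hquot_ge).ne']
    exact (abs_add_le _ _).trans (by gcongr)

theorem meanSquareBounded_log_norm_regularizedLerch (lam : ℝ) (hα : 0 < α) (hα' : α ≤ 1) :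
    MeanSquareBounded (fun s => Real.log ‖regularizedLerch lam α s‖) (1 / 2) := by
  obtain ⟨B, hB⟩ := exists_norm_summatoryRemainder_lerchCoeff_le lam hα hα'
  have hpi : 0 < (2 - Real.pi ^ 2 / 6) / 3 := by nlinarith [Real.pi_lt_d2, Real.pi_pos]
  exact (meanSquareBounded_regularizedSeries hα hα' (fun n => (norm_lerchCoeff lam n).le)
      (norm_lerchResidue_le_one lam) hB).log_norm (measurable_regularizedSeries _ _ _)
    ((differentiableOn_regularizedLerch lam hα hα').mono fun s (hs : 1 / 2 < s.re) =>
      show 0 < s.re by linarith) hpi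
    fun s hs => two_sub_div_three_le_norm_regularizedLerch lam hα hα' hs

theorem meanSquareBounded_log_norm_lerchZeta (lam : ℝ) (hα : 0 < α) (hα' : α ≤ 1) :
    MeanSquareBounded (fun s => Real.log ‖lerchZeta lam α s‖) (1 / 2) := by
  have hreg := meanSquareBounded_log_norm_regularizedLerch lam hα hα'
  refine hreg.of_norm_le_add (meanSquareBounded_log_one_add_div_abs_im zero_le_two _) ?_
    fun s hs him => ?_
  · have hmeas : Measurable (regularizedLerch lam α) := measurable_regularizedSeries _ _ _
    fun_prop
  · have hs1 : s ≠ 1 := by rintro rfl; exact him Complex.one_im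
    exact (abs_log_norm_le_of_mul_sub_one_eq (by linarith) him
      (lerchZeta_mul_sub_one lam hα hα' (by linarith) hs1)).trans
      (add_le_add le_rfl (Real.le_norm_self _))

theorem aestronglyMeasurable_log_norm_lerchZeta (lam : ℝ) (hα : 0 < α) (hα' : α ≤ 1) {σ : ℝ}
    (hσ : 0 < σ) :
    AEStronglyMeasurable fun t : ℝ => Real.log ‖lerchZeta lam α (σ + t * Complex.I)‖ := by
  have hmeas : Measurable (regularizedLerch lam α) := measurable_regularizedSeries _ _ _
  have hquot : Measurable fun s => Real.log ‖regularizedLerch lam α s * (s + 1) / (s - 1)‖ := by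
    fun_prop
  refine (hquot.comp (by fun_prop : Measurable fun t : ℝ => σ + t * Complex.I)
    |>.aestronglyMeasurable).congr ?_
  filter_upwards [Measure.ae_ne volume (0 : ℝ)] with t ht
  have hs1 : (σ + t * Complex.I : ℂ) ≠ 1 := fun h => ht (by simpa using congrArg Complex.im h)
  rw [Function.comp_apply, ← lerchZeta_mul_sub_one lam hα hα' (by simpa using hσ) hs1,
    mul_div_cancel_right₀ _ (sub_ne_zero.2 hs1)]

end Lerch

theorem mainTheorem6 (lam α σ₁ ε₁ : ℝ) (hα : 0 < α) (hα' : α ≤ 1) (hσ₁ : 0 < σ₁)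
    (hε₁ : 0 < ε₁) :
    ∃ T₀ : ℝ, 0 < T₀ ∧ ∃ C : ℝ, 0 < C ∧
      ∀ T : ℝ, T₀ ≤ T → ∀ σ : ℝ, 1 / 2 + ε₁ ≤ σ → σ ≤ σ₁ →
        IntervalIntegrable
          (fun t : ℝ => Real.log ‖lerchZeta lam α ((σ : ℂ) + (t : ℂ) * Complex.I)‖ ^ 2)
          MeasureTheory.volume 0 T ∧
        ∫ t in (0 : ℝ)..T,
          Real.log ‖lerchZeta lam α ((σ : ℂ) + (t : ℂ) * Complex.I)‖ ^ 2 ≤ C * T := by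
  obtain ⟨C, hC, hbound⟩ := (meanSquareBounded_log_norm_lerchZeta lam hα hα').exists_integral_sq_le
    (by linarith : 1 / 2 < 1 / 2 + ε₁)
    fun σ hσ => aestronglyMeasurable_log_norm_lerchZeta lam hα hα' (by linarith)
  exact ⟨1, one_pos, C, hC, hbound⟩
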